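/- Let $(M,\xi)$ be a nonempty closed (compact, without boundary) co-oriented contact manifold of dimension $2n+1$, i.e. $\xi=\ker\alpha$ for a smooth $1$-form $\alpha$ with $\alpha\wedge(d\alpha)^n$ nowhere vanishing, and fix such a contact form $\alpha$ inducing the given co-orientation. Let $\mathrm{Cont}_0(M)$ be the group of diffeomorphisms of $M$ that are isotopic to $\mathrm{id}_M$ through contactomorphisms (diffeomorphisms preserving $\xi$). For a smooth isotopy $(\phi_t)_{t\in[0,1]}$ of contactomorphisms let $X_t^\phi$ be the vector field with $X_t^\phi\circ\phi_t=\frac{d}{ds}\big|_{s=t}\phi_s$. The isotopy is called positive (non-negative) if $\alpha(X_t^\phi)>0$ (resp. $\geq 0$) on $M$ for all $t\in[0,1]$; this depends only on the co-orientation. For $\phi,\psi\in\mathrm{Cont}_0(M)$ write $\phi\ll\psi$ (resp. $\phi\preccurlyeq\psi$) if there is a positive (resp. non-negative) isotopy from $\phi$ to $\psi$. The interval topology on $\mathrm{Cont}_0(M)$ is the topology generated by the sets $\{\chi : \phi\ll\chi\ll\psi\}$, $\phi,\psi\in \mathrm{Cont}_0(M)$. The Shelukhin–Hofer norm and metric are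 $$|\phi|_\alpha=\inf\Big\{\int_0^1\max_M|\alpha(X_t^\phi)|\,dt\Big\},\qquad d_\alpha(\phi,\psi)=|\psi^{-1}\phi|_\alpha,$$ where the infimum is over all smooth isotopies of contactomorphisms from $\mathrm{id}_M$ to $\phi$. The Lorentzian distance $\tau_\alpha:\mathrm{Cont}_0(M)\times\mathrm{Cont}_0(M)\to[0,\infty]$ is $$\tau_\alpha(\phi,\psi)=\sup\Big\{\int_0^1\min_M\alpha(X_t^\phi)\,dt\Big\}\ \text{ if }\phi\preccurlyeq\psi,\qquad \tau_\alpha(\phi,\psi)=0\ \text{ otherwise},$$ where the supremum is over all non-negative isotopies $(\phi_t)$ with $\phi_0=\phi$ and $\phi_1=\psi$. For $\psi\in\mathrm{Cont}_0(M)$, $\tau_{\psi^*\alpha}$ is defined in the same way with $\psi^*\alpha$ in place of $\alpha$. Then: (i) for all $\phi,\psi\in\mathrm{Cont}_0(M)$: $\tau_\alpha(\phi,\psi)>0$ if and only if $\phi\ll\psi$; (ii) $\tau_\alpha$ is continuous on $\mathrm{Cont}_0(M)\times\mathrm{Cont}_0(M)$ when both factors carry the interval topology, and also when both factors carry the topology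 induced by $d_\alpha$ (with the usual topology on $[0,\infty]$); (iii) $\tau_\alpha(\phi_1,\phi_2)\geq\tau_\alpha(\phi_1,\psi)+\tau_\alpha(\psi,\phi_2)$ whenever $\phi_1\preccurlyeq\psi\preccurlyeq\phi_2$; (iv) $\tau_\alpha(\psi\phi_1,\psi\phi_2)=\tau_{\psi^*\alpha}(\phi_1,\phi_2)$ for all $\psi,\phi_1,\phi_2\in\mathrm{Cont}_0(M)$. -/

import Mathlib

open scoped Manifold ContDiff ENNReal

noncomputable section

namespace ContactGeometry

/-! ### Differential forms and the contact condition -/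

section Forms

variable {n : ℕ} {M : Type*} [TopologicalSpace M]
  [ChartedSpace (EuclideanSpace ℝ (Fin (2 * n + 1))) M]

/-- A (not necessarily smooth) `1`-form on the `(2n+1)`-dimensional manifold `M`. -/
abbrev OneForm (n : ℕ) (M : Type*) [TopologicalSpace M]
    [ChartedSpace (EuclideanSpace ℝ (Fin (2 * n + 1))) M] : Type _ :=
  ∀ x : M, TangentSpace (𝓡 (2 * n + 1)) x →L[ℝ] ℝ

/-- Smoothness of a `1`-form, as a section of the cotangent bundle `Hom (TM, ℝ)`. -/
def OneForm.IsSmooth [IsManifold (𝓡 (2 * n + 1)) ∞ M] (α : OneForm n M) : Prop :=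
  ContMDiff (𝓡 (2 * n + 1))
    ((𝓡 (2 * n + 1)).prod 𝓘(ℝ, EuclideanSpace ℝ (Fin (2 * n + 1)) →L[ℝ] ℝ)) ∞
    (fun x : M => Bundle.TotalSpace.mk' (EuclideanSpace ℝ (Fin (2 * n + 1)) →L[ℝ] ℝ)
      (E := fun x : M => TangentSpace (𝓡 (2 * n + 1)) x →L[ℝ] ℝ) x (α x))

/-- The coordinate expression of the `1`-form `α` in the preferred chart at `x₀`, i.e. the
pullback of `α` under the inverse of this chart. -/
def OneForm.inChart (α : OneForm n M) (x₀ : M) (y : EuclideanSpace ℝ (Fin (2 * n + 1))) :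
    EuclideanSpace ℝ (Fin (2 * n + 1)) →L[ℝ] ℝ :=
  (α ((extChartAt (𝓡 (2 * n + 1)) x₀).symm y)).comp
    (mfderiv 𝓘(ℝ, EuclideanSpace ℝ (Fin (2 * n + 1))) (𝓡 (2 * n + 1))
      (extChartAt (𝓡 (2 * n + 1)) x₀).symm y)

/-- The exterior derivative `dα` at `x`: in the chart at `x` it is
`dα (v, w) = (D_v α)(w) - (D_w α)(v)`. Tangent vectors at `x` are, by the definition of
`TangentSpace`, represented by their coordinates in the preferred chart at `x`. -/
def OneForm.d (α : OneForm n M) (x : M) (v w : TangentSpace (𝓡 (2 * n + 1)) x) : ℝ :=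
  fderiv ℝ (α.inChart x) (extChartAt (𝓡 (2 * n + 1)) x x) v w
    - fderiv ℝ (α.inChart x) (extChartAt (𝓡 (2 * n + 1)) x x) w v

/-- The `(2n+1)`-form `α ∧ (dα)^n` at `x`, up to a positive constant depending only on `n`:
the antisymmetrization of `α ⊗ dα ⊗ ⋯ ⊗ dα`. -/
def OneForm.wedgeDPow (α : OneForm n M) (x : M)
    (v : Fin (2 * n + 1) → TangentSpace (𝓡 (2 * n + 1)) x) : ℝ :=
  ∑ σ : Equiv.Perm (Fin (2 * n + 1)), ((Equiv.Perm.sign σ : ℤ) : ℝ) *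
    (α x (v (σ 0)) *
      ∏ i : Fin n, α.d x (v (σ ⟨2 * i + 1, by omega⟩)) (v (σ ⟨2 * i + 2, by omega⟩)))

/-- A contact form: a smooth `1`-form `α` such that `α ∧ (dα)^n` is nowhere vanishing. -/
structure OneForm.IsContact [IsManifold (𝓡 (2 * n + 1)) ∞ M] (α : OneForm n M) : Prop where
  smooth : α.IsSmooth
  nondegenerate : ∀ x : M, ∃ v, α.wedgeDPow x v ≠ 0

/-- The pullback `ψ^* α` of a `1`-form by a map. -/
def OneForm.pullback (ψ : M → M) (α : OneForm n M) : OneForm n M := fun x =>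
  (α (ψ x)).comp (mfderiv (𝓡 (2 * n + 1)) (𝓡 (2 * n + 1)) ψ x)

end Forms

/-! ### The group of diffeomorphisms -/

/-- The smooth diffeomorphisms of `M`, a group under composition `(φ * ψ) x = φ (ψ x)`. -/
abbrev Diffeo (n : ℕ) (M : Type*) [TopologicalSpace M]
    [ChartedSpace (EuclideanSpace ℝ (Fin (2 * n + 1))) M] : Type _ :=
  Diffeomorph (𝓡 (2 * n + 1)) (𝓡 (2 * n + 1)) M M ∞

instance Diffeo.instGroup (n : ℕ) (M : Type*) [TopologicalSpace M]
    [ChartedSpace (EuclideanSpace ℝ (Fin (2 * n + 1))) M] : Group (Diffeo n M) where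
  mul φ ψ := ψ.trans φ
  one := Diffeomorph.refl _ M ∞
  inv φ := φ.symm
  mul_assoc _ _ _ := rfl
  one_mul _ := rfl
  mul_one _ := rfl
  inv_mul_cancel φ := φ.self_trans_symm

theorem Diffeo.coe_mul {n : ℕ} {M : Type*} [TopologicalSpace M]
    [ChartedSpace (EuclideanSpace ℝ (Fin (2 * n + 1))) M] (φ ψ : Diffeo n M) :
    ⇑(φ * ψ) = φ ∘ ψ := rfl

theorem Diffeo.coe_one {n : ℕ} {M : Type*} [TopologicalSpace M]
    [ChartedSpace (EuclideanSpace ℝ (Fin (2 * n + 1))) M] :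
    ⇑(1 : Diffeo n M) = id := rfl

/-! ### Co-oriented contact structures, contactomorphisms, isotopies -/

/-- A co-oriented contact structure on `M`: a hyperplane distribution `ξ` together with one of
the two sides of `ξ x` in each tangent space, which is globally given as `ξ = ker α`, with
positive side `{α > 0}`, for some contact form `α`. -/
structure CoorientedContactStructure (n : ℕ) (M : Type*) [TopologicalSpace M]
    [ChartedSpace (EuclideanSpace ℝ (Fin (2 * n + 1))) M]
    [IsManifold (𝓡 (2 * n + 1)) ∞ M] where
  /-- the contact distribution -/
  ξ : ∀ x : M, Submodule ℝ (TangentSpace (𝓡 (2 * n + 1)) x)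
  /-- the positive side of the contact distribution -/
  pos : ∀ x : M, Set (TangentSpace (𝓡 (2 * n + 1)) x)
  exists_form : ∃ α : OneForm n M, α.IsContact ∧
    ∀ (x : M) (v : TangentSpace (𝓡 (2 * n + 1)) x),
      (v ∈ ξ x ↔ α x v = 0) ∧ (v ∈ pos x ↔ 0 < α x v)

variable {n : ℕ} {M : Type*} [TopologicalSpace M]
  [ChartedSpace (EuclideanSpace ℝ (Fin (2 * n + 1))) M] [IsManifold (𝓡 (2 * n + 1)) ∞ M]

namespace CoorientedContactStructure

/-- `α` is a contact form for the co-oriented contact structure `Ξ`: it is a contact form with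
kernel `ξ`, inducing the given co-orientation. -/
structure IsContactForm (Ξ : CoorientedContactStructure n M) (α : OneForm n M) : Prop where
  isContact : α.IsContact
  mem_ξ_iff : ∀ (x : M) (v : TangentSpace (𝓡 (2 * n + 1)) x), v ∈ Ξ.ξ x ↔ α x v = 0
  mem_pos_iff : ∀ (x : M) (v : TangentSpace (𝓡 (2 * n + 1)) x), v ∈ Ξ.pos x ↔ 0 < α x v

/-- A contactomorphism: a diffeomorphism whose differential maps `ξ` onto `ξ`. -/
def IsContactomorphism (Ξ : CoorientedContactStructure n M) (φ : Diffeo n M) : Prop :=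
  ∀ x : M, (Ξ.ξ x).map (mfderiv (𝓡 (2 * n + 1)) (𝓡 (2 * n + 1)) φ x).toLinearMap = Ξ.ξ (φ x)

/-- A smooth isotopy `(φ_t)`, `t ∈ [0, 1]`, of contactomorphisms: `(t, x) ↦ φ_t x` is smooth on
`[0, 1] × M`. The values for `t ∉ [0, 1]` are irrelevant. -/
structure Isotopy (Ξ : CoorientedContactStructure n M) where
  /-- the diffeomorphism `φ_t` -/
  map : ℝ → Diffeo n M
  smooth : ContMDiffOn (𝓘(ℝ, ℝ).prod (𝓡 (2 * n + 1))) (𝓡 (2 * n + 1)) ∞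
    (fun p : ℝ × M => map p.1 p.2) (Set.Icc (0 : ℝ) 1 ×ˢ Set.univ)
  isContactomorphism : ∀ t ∈ Set.Icc (0 : ℝ) 1, Ξ.IsContactomorphism (map t)

namespace Isotopy

variable {Ξ : CoorientedContactStructure n M}

/-- `X_t (φ_t x) = d/ds|_{s = t} φ_s x`, where `X_t` is the contact vector field generating the
isotopy (the derivative is one-sided at the end points of `[0, 1]`). -/
def velocity (γ : Ξ.Isotopy) (t : ℝ) (x : M) : TangentSpace (𝓡 (2 * n + 1)) (γ.map t x) :=
  mfderivWithin 𝓘(ℝ, ℝ) (𝓡 (2 * n + 1)) (fun s : ℝ => γ.map s x) (Set.Icc (0 : ℝ) 1) t (1 : ℝ)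

/-- The isotopy is positive: `X_t` lies everywhere on the positive side of `ξ`. -/
def IsPositive (γ : Ξ.Isotopy) : Prop :=
  ∀ t ∈ Set.Icc (0 : ℝ) 1, ∀ x : M, γ.velocity t x ∈ Ξ.pos (γ.map t x)

/-- The isotopy is non-negative: `X_t` lies nowhere on the negative side of `ξ`. -/
def IsNonneg (γ : Ξ.Isotopy) : Prop :=
  ∀ t ∈ Set.Icc (0 : ℝ) 1, ∀ x : M,
    γ.velocity t x ∈ Ξ.pos (γ.map t x) ∨ γ.velocity t x ∈ Ξ.ξ (γ.map t x)

/-- `∫₀¹ min_M α(X_t) dt`. As `φ_t` is a bijection of `M`, the minimum of `α(X_t)` over `M` is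
the minimum of `α(X_t)(φ_t x)` over `x`. -/
def lorentzLength (α : OneForm n M) (γ : Ξ.Isotopy) : ℝ :=
  ∫ t in (0 : ℝ)..1, ⨅ x : M, α (γ.map t x) (γ.velocity t x)

/-- `∫₀¹ max_M |α(X_t)| dt`. -/
def hoferLength (α : OneForm n M) (γ : Ξ.Isotopy) : ℝ :=
  ∫ t in (0 : ℝ)..1, ⨆ x : M, |α (γ.map t x) (γ.velocity t x)|

end Isotopy

theorem IsContactomorphism.one (Ξ : CoorientedContactStructure n M) :
    Ξ.IsContactomorphism 1 := by
  intro x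
  rw [Diffeo.coe_one, mfderiv_id]
  exact Submodule.map_id _

theorem IsContactomorphism.mul {Ξ : CoorientedContactStructure n M} {φ ψ : Diffeo n M}
    (hφ : Ξ.IsContactomorphism φ) (hψ : Ξ.IsContactomorphism ψ) :
    Ξ.IsContactomorphism (φ * ψ) := by
  intro x
  rw [Diffeo.coe_mul, mfderiv_comp x (φ.mdifferentiable (by simp) _)
    (ψ.mdifferentiable (by simp) _)]
  refine (Submodule.map_comp _ _ _).trans ?_
  rw [hψ x]
  exact hφ (ψ x)

theorem IsContactomorphism.inv {Ξ : CoorientedContactStructure n M} {φ : Diffeo n M}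
    (hφ : Ξ.IsContactomorphism φ) : Ξ.IsContactomorphism φ⁻¹ := by
  intro x
  obtain ⟨y, rfl⟩ : ∃ y, φ y = x := φ.surjective x
  have hy : (φ⁻¹ : Diffeo n M) (φ y) = y := φ.symm_apply_apply y
  have hc : (mfderiv (𝓡 (2 * n + 1)) (𝓡 (2 * n + 1)) (φ⁻¹ : Diffeo n M) (φ y)).comp
      (mfderiv (𝓡 (2 * n + 1)) (𝓡 (2 * n + 1)) φ y) =
      ContinuousLinearMap.id ℝ (EuclideanSpace ℝ (Fin (2 * n + 1))) := by
    have h := mfderiv_comp (I := 𝓡 (2 * n + 1)) (I' := 𝓡 (2 * n + 1)) (I'' := 𝓡 (2 * n + 1)) y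
      ((φ⁻¹ : Diffeo n M).mdifferentiable (by simp) (φ y)) (φ.mdifferentiable (by simp) y)
    have h2 : (⇑(φ⁻¹ : Diffeo n M) ∘ φ) = id := funext fun z => φ.symm_apply_apply z
    rw [h2, mfderiv_id] at h
    exact h.symm
  rw [← hφ y, hy]
  refine (Submodule.map_comp _ _ _).symm.trans ?_
  refine Eq.trans ?_ (Submodule.map_id (Ξ.ξ y))
  exact congrArg (fun L : EuclideanSpace ℝ (Fin (2 * n + 1)) →L[ℝ]
    EuclideanSpace ℝ (Fin (2 * n + 1)) => Submodule.map L.toLinearMap (Ξ.ξ y)) hc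

/-- `Cont₀(M)`: the group of diffeomorphisms preserving `ξ` that are isotopic to the identity
through contactomorphisms. -/
def Cont₀ (Ξ : CoorientedContactStructure n M) : Subgroup (Diffeo n M) where
  carrier := {φ | ∃ γ : Ξ.Isotopy, γ.map 0 = 1 ∧ γ.map 1 = φ}
  one_mem' := ⟨⟨fun _ => 1, contMDiffOn_snd, fun _ _ => IsContactomorphism.one Ξ⟩, rfl, rfl⟩
  mul_mem' := by
    rintro φ ψ ⟨γ, hγ0, hγ1⟩ ⟨δ, hδ0, hδ1⟩
    refine ⟨⟨fun t => γ.map t * δ.map t, ?_, fun t ht =>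
      (γ.isContactomorphism t ht).mul (δ.isContactomorphism t ht)⟩, ?_, ?_⟩
    · exact γ.smooth.comp (contMDiffOn_fst.prodMk δ.smooth) fun p hp => ⟨hp.1, trivial⟩
    · simp [hγ0, hδ0]
    · simp [hγ1, hδ1]
  inv_mem' := by
    rintro φ ⟨γ, hγ0, hγ1⟩
    have hφ : Ξ.IsContactomorphism φ := hγ1 ▸ γ.isContactomorphism 1 (by simp)
    refine ⟨⟨fun t => γ.map (1 - t) * φ⁻¹, ?_, fun t ht =>
      (γ.isContactomorphism (1 - t) (by constructor <;> linarith [ht.1, ht.2])).mul hφ.inv⟩,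
      ?_, ?_⟩
    · have h1 : ContMDiffOn (𝓘(ℝ, ℝ).prod (𝓡 (2 * n + 1))) 𝓘(ℝ, ℝ) ∞
          (fun p : ℝ × M => 1 - p.1) (Set.Icc (0 : ℝ) 1 ×ˢ Set.univ) :=
        contMDiffOn_const.sub contMDiffOn_fst
      have h2 : ContMDiffOn (𝓘(ℝ, ℝ).prod (𝓡 (2 * n + 1))) (𝓡 (2 * n + 1)) ∞
          (fun p : ℝ × M => (φ⁻¹ : Diffeo n M) p.2) (Set.Icc (0 : ℝ) 1 ×ˢ Set.univ) :=
        (φ⁻¹ : Diffeo n M).contMDiff.comp_contMDiffOn contMDiffOn_snd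
      exact γ.smooth.comp (h1.prodMk h2) fun p hp =>
        ⟨by constructor <;> linarith [hp.1.1, hp.1.2], trivial⟩
    · simp [hγ1]
    · simp [hγ0]

variable (Ξ : CoorientedContactStructure n M)

/-- `φ ≪ ψ`: there is a positive isotopy from `φ` to `ψ`. -/
def ChronBefore (φ ψ : Ξ.Cont₀) : Prop :=
  ∃ γ : Ξ.Isotopy, γ.map 0 = φ ∧ γ.map 1 = ψ ∧ γ.IsPositive

/-- `φ ≼ ψ`: there is a non-negative isotopy from `φ` to `ψ`. -/
def CausalBefore (φ ψ : Ξ.Cont₀) : Prop :=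
  ∃ γ : Ξ.Isotopy, γ.map 0 = φ ∧ γ.map 1 = ψ ∧ γ.IsNonneg

/-- The chronological future `I⁺(φ)`. -/
def chronFuture (φ : Ξ.Cont₀) : Set Ξ.Cont₀ := {ψ | Ξ.ChronBefore φ ψ}

/-- The chronological past `I⁻(φ)`. -/
def chronPast (φ : Ξ.Cont₀) : Set Ξ.Cont₀ := {ψ | Ξ.ChronBefore ψ φ}

/-- The interval topology on `Cont₀(M)`, generated by the sets `I⁺(φ) ∩ I⁻(ψ)`. -/
@[reducible] def intervalTopology : TopologicalSpace Ξ.Cont₀ :=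
  TopologicalSpace.generateFrom
    {U | ∃ φ ψ : Ξ.Cont₀, U = Ξ.chronFuture φ ∩ Ξ.chronPast ψ}

/-- The Shelukhin–Hofer norm `|φ|_α`: the infimum of `∫₀¹ max_M |α(X_t)| dt` over all contact
isotopies from the identity to `φ`. -/
def hoferNorm (α : OneForm n M) (φ : Ξ.Cont₀) : ℝ :=
  sInf {ℓ : ℝ | ∃ γ : Ξ.Isotopy, γ.map 0 = 1 ∧ γ.map 1 = φ ∧ ℓ = γ.hoferLength α}

/-- The Shelukhin–Hofer metric `d_α(φ, ψ) = |ψ⁻¹ φ|_α`. -/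
def hoferDist (α : OneForm n M) (φ ψ : Ξ.Cont₀) : ℝ := Ξ.hoferNorm α (ψ⁻¹ * φ)

/-- The topology induced by `d_α`: `U` is open iff it contains a `d_α`-ball around each of its
points. -/
@[reducible] def hoferTopology (α : OneForm n M) : TopologicalSpace Ξ.Cont₀ where
  IsOpen U := ∀ φ ∈ U, ∃ ε > 0, ∀ ψ, Ξ.hoferDist α φ ψ < ε → ψ ∈ U
  isOpen_univ := fun _ _ => ⟨1, one_pos, fun _ _ => trivial⟩
  isOpen_inter := by
    rintro U V hU hV φ ⟨hφU, hφV⟩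
    obtain ⟨ε, hε, h⟩ := hU φ hφU
    obtain ⟨δ, hδ, h'⟩ := hV φ hφV
    exact ⟨min ε δ, lt_min hε hδ, fun ψ hψ =>
      ⟨h ψ (hψ.trans_le (min_le_left _ _)), h' ψ (hψ.trans_le (min_le_right _ _))⟩⟩
  isOpen_sUnion := by
    rintro S hS φ ⟨U, hU, hφ⟩
    obtain ⟨ε, hε, h⟩ := hS U hU φ hφ
    exact ⟨ε, hε, fun ψ hψ => ⟨U, hU, h ψ hψ⟩⟩

open Classical in
/-- The Lorentzian distance `τ_α(φ, ψ) ∈ [0, ∞]`: the supremum of `∫₀¹ min_M α(X_t) dt` over all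
non-negative isotopies from `φ` to `ψ` if `φ ≼ ψ`, and `0` otherwise. -/
def lorentzDist (α : OneForm n M) (φ ψ : Ξ.Cont₀) : ℝ≥0∞ :=
  if Ξ.CausalBefore φ ψ then
    sSup {ℓ : ℝ≥0∞ | ∃ γ : Ξ.Isotopy, γ.map 0 = φ ∧ γ.map 1 = ψ ∧ γ.IsNonneg ∧
      ℓ = ENNReal.ofReal (γ.lorentzLength α)}
  else 0

end CoorientedContactStructure

end ContactGeometry

end

noncomputable section

set_option linter.unusedSectionVars false

namespace ContactGeometry

open Set Filter
open scoped Topology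

variable {n : ℕ} {M : Type*} [TopologicalSpace M]
  [ChartedSpace (EuclideanSpace ℝ (Fin (2 * n + 1))) M] [IsManifold (𝓡 (2 * n + 1)) ∞ M]

/-! ### Regularity of isotopies -/

/-! Write `speed` for the contact Hamiltonian `α(X_t) ∘ φ_t` of an isotopy. Everything rests on one
product formula, `speed_reparam_mul`: the isotopy `t ↦ γ_{g t} δ_t` has Hamiltonian `g' · (speed of
γ at time g) + (conformal factor of γ_{g t}) · (speed of δ)`, evaluated along the orbit. Conformal
factors of elements of `Cont₀` are positive, and compactness of `M` bounds them. Each construction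
below is such a product with a well-chosen `g`.

Concatenation is the product of two isotopies, one of which rests while the other moves. It gives
the reverse triangle inequality, hence monotonicity of `τ_α`. For (i), a non-negative isotopy of
positive length is strictly positive on some time interval. Multiplying by a small loop spreads this
surplus over all times (`exists_isPositive`).

For the interval topology, lower semicontinuity comes from cutting two short pieces of positive
length off the ends of an almost maximal isotopy. For upper semicontinuity, let `ζ` be a positive
isotopy through the identity. Move the end points apart to `ζ_b⁻¹ φ` and `ζ_a⁻¹ ψ`, with `a` and `b`
on either side of the identity time. An isotopy between the new end points, multiplied by `ζ` run
backwards from `b` to `a`, joins `φ` to `ψ` and loses little length (`ofReal_sub_le_lorentzDist`),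
so it cannot be much longer than `τ_α(φ, ψ)`. If there is no positive isotopy at all, `τ_α` vanishes
by (i).

For `d_α`, a positive isotopy survives multiplication by an isotopy of small Hofer length once its
clock runs faster where the perturbation is large (`exists_mul_isPositive`). So intervals are open
for `d_α`, and continuity passes to this finer topology. Part (iv) holds because left translation by
`ψ` turns `α`-length into `ψ^*α`-length and preserves non-negativity. -/

theorem OneForm.IsSmooth.continuous_apply {α : OneForm n M} (hα : α.IsSmooth) :
    Continuous fun v : TangentBundle (𝓡 (2 * n + 1)) M => α v.1 v.2 := by
  have h1 : Continuous fun v : TangentBundle (𝓡 (2 * n + 1)) M =>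
      (Bundle.TotalSpace.mk' (EuclideanSpace ℝ (Fin (2 * n + 1)) →L[ℝ] ℝ)
        (E := fun x : M => TangentSpace (𝓡 (2 * n + 1)) x →L[ℝ] Bundle.Trivial M ℝ x) v.1 (α v.1)) :=
    hα.continuous.comp (FiberBundle.continuous_proj _ _)
  have h2 : Continuous fun v : TangentBundle (𝓡 (2 * n + 1)) M =>
      Bundle.TotalSpace.mk' (EuclideanSpace ℝ (Fin (2 * n + 1)))
        (E := TangentSpace (𝓡 (2 * n + 1))) v.1 v.2 := continuous_id
  have h3 := h1.clm_bundle_apply (F₂ := ℝ) (E₂ := Bundle.Trivial M ℝ) h2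
  exact (Bundle.Trivial.homeomorphProd M ℝ).continuous.comp h3 |>.snd

namespace CoorientedContactStructure.Isotopy

variable {Ξ : CoorientedContactStructure n M}

theorem uniqueMDiffOn_slab : UniqueMDiffOn (𝓘(ℝ, ℝ).prod (𝓡 (2 * n + 1)))
    (Icc (0 : ℝ) 1 ×ˢ (univ : Set M)) :=
  (uniqueDiffOn_Icc one_pos).uniqueMDiffOn.prod uniqueMDiffOn_univ

/-- The differential of `(t, x) ↦ φ_t x` on `[0, 1] × M`. -/
def totalDeriv (γ : Ξ.Isotopy) (t : ℝ) (x : M) :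
    ℝ × EuclideanSpace ℝ (Fin (2 * n + 1)) →L[ℝ] TangentSpace (𝓡 (2 * n + 1)) (γ.map t x) :=
  mfderivWithin (𝓘(ℝ, ℝ).prod (𝓡 (2 * n + 1))) (𝓡 (2 * n + 1))
    (fun p : ℝ × M => γ.map p.1 p.2) (Icc (0 : ℝ) 1 ×ˢ univ) (t, x)

theorem mdifferentiableWithinAt (γ : Ξ.Isotopy) {t : ℝ} (ht : t ∈ Icc (0 : ℝ) 1) (x : M) :
    MDifferentiableWithinAt (𝓘(ℝ, ℝ).prod (𝓡 (2 * n + 1))) (𝓡 (2 * n + 1))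
      (fun p : ℝ × M => γ.map p.1 p.2) (Icc (0 : ℝ) 1 ×ˢ univ) (t, x) :=
  (γ.smooth (t, x) ⟨ht, trivial⟩).mdifferentiableWithinAt (by simp)

theorem hasMFDerivWithinAt (γ : Ξ.Isotopy) {t : ℝ} (ht : t ∈ Icc (0 : ℝ) 1) (x : M) :
    HasMFDerivWithinAt (𝓘(ℝ, ℝ).prod (𝓡 (2 * n + 1))) (𝓡 (2 * n + 1))
      (fun p : ℝ × M => γ.map p.1 p.2) (Icc (0 : ℝ) 1 ×ˢ univ) (t, x) (γ.totalDeriv t x) :=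
  (γ.mdifferentiableWithinAt ht x).hasMFDerivWithinAt

/-- Velocity of a curve `s ↦ φ_{g s} (c s)`. -/
theorem hasMFDerivWithinAt_comp_curve (γ : Ξ.Isotopy) {g : ℝ → ℝ} {c : ℝ → M} {t g' : ℝ}
    {s : Set ℝ} {c' : EuclideanSpace ℝ (Fin (2 * n + 1))} (hgs : MapsTo g s (Icc 0 1))
    (hgt : g t ∈ Icc (0 : ℝ) 1) (hg : HasDerivWithinAt g g' s t)
    (hc : HasMFDerivWithinAt 𝓘(ℝ, ℝ) (𝓡 (2 * n + 1)) c s t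
      (ContinuousLinearMap.toSpanSingleton ℝ c' : ℝ →L[ℝ] EuclideanSpace ℝ (Fin (2 * n + 1)))) :
    HasMFDerivWithinAt 𝓘(ℝ, ℝ) (𝓡 (2 * n + 1)) (fun r => γ.map (g r) (c r)) s t
      (ContinuousLinearMap.toSpanSingleton ℝ (γ.totalDeriv (g t) (c t) (g', c')) :
        ℝ →L[ℝ] EuclideanSpace ℝ (Fin (2 * n + 1))) := by
  have h1 := hg.hasFDerivWithinAt.hasMFDerivWithinAt.prodMk hc
  have h2 := HasMFDerivWithinAt.comp (f := fun r => (g r, c r)) t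
    (γ.hasMFDerivWithinAt hgt (c t)) h1 fun r hr => (⟨hgs hr, trivial⟩ : _ ∧ _)
  refine h2.congr_mfderiv (ContinuousLinearMap.ext_ring ?_)
  change γ.totalDeriv (g t) (c t) ((1 : ℝ) • g', (1 : ℝ) • c') = (1 : ℝ) • _
  rw [one_smul, one_smul, one_smul]

theorem velocity_eq (γ : Ξ.Isotopy) {t : ℝ} (ht : t ∈ Icc (0 : ℝ) 1) (x : M) :
    γ.velocity t x = γ.totalDeriv t x (1, 0) := by
  have h := γ.hasMFDerivWithinAt_comp_curve (c := fun _ => x) (c' := 0) (mapsTo_id _) ht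
    (hasDerivWithinAt_id t _) (
      (hasMFDerivWithinAt_const x (Icc (0 : ℝ) 1) t).congr_mfderiv
        (ContinuousLinearMap.ext_ring (smul_zero (1 : ℝ)).symm))
  have := h.mfderivWithin ((uniqueDiffOn_Icc one_pos).uniqueMDiffOn t ht)
  simp only [id] at this
  rw [velocity, this]
  exact one_smul ℝ _

theorem mfderiv_map_eq (γ : Ξ.Isotopy) {t : ℝ} (ht : t ∈ Icc (0 : ℝ) 1) (x : M)
    (v : TangentSpace (𝓡 (2 * n + 1)) x) :
    mfderiv (𝓡 (2 * n + 1)) (𝓡 (2 * n + 1)) (γ.map t) x v = γ.totalDeriv t x (0, v) := by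
  have h1 : HasMFDerivAt (𝓡 (2 * n + 1)) (𝓘(ℝ, ℝ).prod (𝓡 (2 * n + 1))) (fun y : M => (t, y)) x
      ((0 : EuclideanSpace ℝ (Fin (2 * n + 1)) →L[ℝ] ℝ).prod
        (ContinuousLinearMap.id ℝ (EuclideanSpace ℝ (Fin (2 * n + 1))))) :=
    (hasMFDerivAt_const t x).prodMk (hasMFDerivAt_id x)
  have h2 := HasMFDerivWithinAt.comp (f := fun y : M => (t, y)) x
    (γ.hasMFDerivWithinAt ht x) (h1.hasMFDerivWithinAt (s := univ))
    fun y _ => (⟨ht, trivial⟩ : _ ∧ _)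
  have h3 := (hasMFDerivWithinAt_univ.1 h2).mfderiv
  exact congrArg (fun L : EuclideanSpace ℝ (Fin (2 * n + 1)) →L[ℝ]
    EuclideanSpace ℝ (Fin (2 * n + 1)) => L v) h3

/-- The tangent map of a smooth map is continuous; the rest identifies `Tℝ × TM` with `T(ℝ × M)`.
The velocity and the space derivative of `γ_t` are both special cases, which gives continuity of
Hamiltonians and of conformal factors. -/
theorem continuousOn_totalDeriv (γ : Ξ.Isotopy) {α : OneForm n M} (hα : α.IsSmooth) :
    ContinuousOn (fun q : ℝ × ℝ × TangentBundle (𝓡 (2 * n + 1)) M =>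
      α (γ.map q.1 q.2.2.1) (γ.totalDeriv q.1 q.2.2.1 (q.2.1, q.2.2.2)))
      {q | q.1 ∈ Icc (0 : ℝ) 1} := by
  have h1 := γ.smooth.continuousOn_tangentMapWithin (by simp) uniqueMDiffOn_slab
  have h2 : Continuous fun q : ℝ × ℝ × TangentBundle (𝓡 (2 * n + 1)) M =>
      (equivTangentBundleProd 𝓘(ℝ, ℝ) ℝ (𝓡 (2 * n + 1)) M).symm
        ((tangentBundleModelSpaceHomeomorph 𝓘(ℝ, ℝ)).symm (q.1, q.2.1), q.2.2) :=
    (contMDiff_equivTangentBundleProd_symm (n := 0)).continuous.comp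
      (((Homeomorph.continuous _).comp (continuous_fst.prodMk continuous_snd.fst)).prodMk
        continuous_snd.snd)
  exact hα.continuous_apply.comp_continuousOn
    (h1.comp h2.continuousOn fun q hq => ⟨hq, trivial⟩)

/-- The contact Hamiltonian `α (X_t) ∘ φ_t` of the isotopy. -/
def speed (γ : Ξ.Isotopy) (α : OneForm n M) (t : ℝ) (x : M) : ℝ :=
  α (γ.map t x) (γ.velocity t x)

theorem continuousOn_speed (γ : Ξ.Isotopy) {α : OneForm n M} (hα : α.IsSmooth) :
    ContinuousOn (fun p : ℝ × M => γ.speed α p.1 p.2) (Icc 0 1 ×ˢ univ) := by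
  have h1 : Continuous fun p : ℝ × M => (p.1, (1 : ℝ),
      Bundle.zeroSection (EuclideanSpace ℝ (Fin (2 * n + 1)))
        (TangentSpace (𝓡 (2 * n + 1)) (M := M)) p.2) :=
    continuous_fst.prodMk (continuous_const.prodMk
      ((Bundle.contMDiff_zeroSection (n := 0) (IB := 𝓡 (2 * n + 1)) ℝ _).continuous.comp
        continuous_snd))
  refine ((γ.continuousOn_totalDeriv hα).comp h1.continuousOn (fun p hp => hp.1)).congr ?_
  rintro ⟨t, x⟩ ⟨ht, -⟩
  simp only [speed, γ.velocity_eq ht]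
  rfl

end CoorientedContactStructure.Isotopy

/-! ### Conformal factors of contactomorphisms -/

theorem OneForm.IsContact.exists_eq_one {α : OneForm n M} (hα : α.IsContact) (x : M) :
    ∃ v, α x v = 1 := by
  have h : ∃ v, α x v ≠ 0 := by
    by_contra! h
    obtain ⟨v, hv⟩ := hα.nondegenerate x
    exact hv (by simp [OneForm.wedgeDPow, h])
  obtain ⟨v, hv⟩ := h
  exact ⟨(α x v)⁻¹ • v, by rw [map_smul, smul_eq_mul, inv_mul_cancel₀ hv]⟩

open Classical in
/-- The factor `r` with `(φ^* α) x = r • α x`, if it exists. -/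
def OneForm.confFactor (α : OneForm n M) (φ : Diffeo n M) (x : M) : ℝ :=
  if h : ∃ r : ℝ, ∀ v, α (φ x) (mfderiv (𝓡 (2 * n + 1)) (𝓡 (2 * n + 1)) φ x v) = r * α x v
  then h.choose else 0

namespace CoorientedContactStructure

variable {Ξ : CoorientedContactStructure n M} {α : OneForm n M}

theorem IsContactForm.pullback_apply (hα : Ξ.IsContactForm α) {φ : Diffeo n M}
    (hφ : Ξ.IsContactomorphism φ) (x : M) (v : TangentSpace (𝓡 (2 * n + 1)) x) :
    α (φ x) (mfderiv (𝓡 (2 * n + 1)) (𝓡 (2 * n + 1)) φ x v) = α.confFactor φ x * α x v := by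
  have h : ∃ r : ℝ, ∀ v, α (φ x) (mfderiv (𝓡 (2 * n + 1)) (𝓡 (2 * n + 1)) φ x v) = r * α x v := by
    obtain ⟨v₀, hv₀⟩ := hα.isContact.exists_eq_one x
    refine ⟨α (φ x) (mfderiv (𝓡 (2 * n + 1)) (𝓡 (2 * n + 1)) φ x v₀), fun v => ?_⟩
    -- The `ξ`-component of `v` is killed by `φ^*α` because `φ` preserves `ξ`, so only the multiple
    -- of `v₀` contributes.
    have h1 : v - α x v • v₀ ∈ Ξ.ξ x := by
      rw [hα.mem_ξ_iff, map_sub, map_smul, hv₀, smul_eq_mul, mul_one, sub_self]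
    have h2 := Submodule.mem_map_of_mem
      (f := (mfderiv (𝓡 (2 * n + 1)) (𝓡 (2 * n + 1)) φ x).toLinearMap) h1
    rw [hφ x, hα.mem_ξ_iff] at h2
    have h3 : α (φ x) (mfderiv (𝓡 (2 * n + 1)) (𝓡 (2 * n + 1)) φ x (v - α x v • v₀)) = 0 := h2
    rw [map_sub, map_smul, map_sub, map_smul, smul_eq_mul] at h3
    linarith
  rw [OneForm.confFactor, dif_pos h]
  exact h.choose_spec v

theorem IsContactForm.confFactor_eq (hα : Ξ.IsContactForm α) {φ : Diffeo n M}
    (hφ : Ξ.IsContactomorphism φ) {x : M} {v : TangentSpace (𝓡 (2 * n + 1)) x} (hv : α x v = 1) :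
    α.confFactor φ x = α (φ x) (mfderiv (𝓡 (2 * n + 1)) (𝓡 (2 * n + 1)) φ x v) := by
  rw [hα.pullback_apply hφ, hv, mul_one]

theorem IsContactForm.confFactor_ne_zero (hα : Ξ.IsContactForm α) {φ : Diffeo n M}
    (hφ : Ξ.IsContactomorphism φ) (x : M) : α.confFactor φ x ≠ 0 := by
  intro h0
  obtain ⟨w, hw⟩ := hα.isContact.exists_eq_one (φ x)
  let e := φ.mfderivToContinuousLinearEquiv (by simp) x
  have h := hα.pullback_apply hφ x (e.symm w)
  rw [h0, zero_mul] at h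
  have : e (e.symm w) = w := e.apply_symm_apply w
  have h' : α (φ x) (e (e.symm w)) = 0 := h
  rw [this, hw] at h'
  exact one_ne_zero h'

theorem IsContactForm.confFactor_one (hα : Ξ.IsContactForm α) (x : M) :
    α.confFactor 1 x = 1 := by
  obtain ⟨v, hv⟩ := hα.isContact.exists_eq_one x
  rw [hα.confFactor_eq (IsContactomorphism.one Ξ) hv]
  have : mfderiv (𝓡 (2 * n + 1)) (𝓡 (2 * n + 1)) (1 : Diffeo n M) x v = v := by
    rw [Diffeo.coe_one, mfderiv_id]; rfl
  rw [this]; exact hv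

/-- Near a given point, the factor is the quotient `(γ_t^*α)(V) / α(V)` for a local extension `V` of
a vector with `α(v₀) = 1`. -/
theorem IsContactForm.continuousOn_confFactor (hα : Ξ.IsContactForm α) (γ : Ξ.Isotopy) :
    ContinuousOn (fun p : ℝ × M => α.confFactor (γ.map p.1) p.2) (Icc 0 1 ×ˢ univ) := by
  rintro ⟨t₀, x₀⟩ h₀
  obtain ⟨v₀, hv₀⟩ := hα.isContact.exists_eq_one x₀
  let V : ∀ x : M, TangentSpace (𝓡 (2 * n + 1)) x :=
    FiberBundle.extend (EuclideanSpace ℝ (Fin (2 * n + 1))) v₀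
  have hV : ContinuousAt (fun x => (⟨x, V x⟩ : TangentBundle (𝓡 (2 * n + 1)) M)) x₀ :=
    (FiberBundle.contMDiffAt_extend (k := 0) (𝓡 (2 * n + 1)) _ v₀).continuousAt
  have hsnd : ContinuousWithinAt (fun p : ℝ × M => (⟨p.2, V p.2⟩ : TangentBundle (𝓡 (2 * n + 1)) M))
      (Icc 0 1 ×ˢ univ) (t₀, x₀) :=
    ContinuousAt.comp_continuousWithinAt (f := fun p : ℝ × M => p.2) (x := (t₀, x₀)) hV
      continuous_snd.continuousWithinAt
  have hden : ContinuousWithinAt (fun p : ℝ × M => α p.2 (V p.2)) (Icc 0 1 ×ˢ univ) (t₀, x₀) :=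
    hα.isContact.smooth.continuous_apply.continuousAt.comp_continuousWithinAt hsnd
  have hd0 : α x₀ (V x₀) = 1 := by
    rw [show V x₀ = v₀ from FiberBundle.extend_apply_self _ v₀]; exact hv₀
  have hnum : ContinuousWithinAt (fun p : ℝ × M => α (γ.map p.1 p.2)
      (γ.totalDeriv p.1 p.2 (0, V p.2))) (Icc 0 1 ×ˢ univ) (t₀, x₀) :=
    ContinuousWithinAt.comp (f := fun p : ℝ × M => (p.1, (0 : ℝ),
        (⟨p.2, V p.2⟩ : TangentBundle (𝓡 (2 * n + 1)) M))) (x := (t₀, x₀))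
      ((γ.continuousOn_totalDeriv hα.isContact.smooth) (t₀, 0, ⟨x₀, V x₀⟩) h₀.1)
      (continuous_fst.continuousWithinAt.prodMk (continuousWithinAt_const.prodMk hsnd))
      fun p hp => hp.1
  refine (hnum.div hden (by simp [hd0])).congr_of_eventuallyEq_of_mem ?_ h₀
  filter_upwards [hden.eventually_ne (by simp [hd0] : α x₀ (V x₀) ≠ 0), self_mem_nhdsWithin]
    with p hp hp1
  rw [Pi.div_apply, ← γ.mfderiv_map_eq hp1.1, hα.pullback_apply (γ.isContactomorphism _ hp1.1)]
  exact (mul_div_cancel_right₀ _ hp).symm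

/-- The factor is continuous in time and never zero, so it cannot change sign. Starting from the
identity, this shows that elements of `Cont₀` preserve the co-orientation. -/
theorem IsContactForm.confFactor_pos (hα : Ξ.IsContactForm α) (γ : Ξ.Isotopy) {x : M}
    (h0 : 0 < α.confFactor (γ.map 0) x) {t : ℝ} (ht : t ∈ Icc (0 : ℝ) 1) :
    0 < α.confFactor (γ.map t) x := by
  have hc : ContinuousOn (fun s => α.confFactor (γ.map s) x) (Icc 0 1) :=
    (hα.continuousOn_confFactor γ).comp (f := fun s : ℝ => (s, x)) (by fun_prop)
      fun s hs => ⟨hs, trivial⟩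
  by_contra! hneg
  have h2 : Icc (α.confFactor (γ.map t) x) (α.confFactor (γ.map 0) x) ⊆ _ :=
    intermediate_value_Icc' ht.1 (hc.mono (Icc_subset_Icc_right ht.2))
  obtain ⟨s, hs, hs0⟩ := h2 ⟨hneg, h0.le⟩
  exact hα.confFactor_ne_zero (γ.isContactomorphism s ⟨hs.1, hs.2.trans ht.2⟩) x hs0

theorem IsContactForm.confFactor_pos_of_mem (hα : Ξ.IsContactForm α) {φ : Diffeo n M}
    (hφ : φ ∈ Ξ.Cont₀) (x : M) : 0 < α.confFactor φ x := by
  obtain ⟨γ, h0, rfl⟩ := hφ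
  exact hα.confFactor_pos γ (by rw [h0, hα.confFactor_one]; exact one_pos) (by simp)

theorem isContactomorphism_of_mem {φ : Diffeo n M} (hφ : φ ∈ Ξ.Cont₀) :
    Ξ.IsContactomorphism φ := by
  obtain ⟨γ, -, rfl⟩ := hφ
  exact γ.isContactomorphism 1 (by simp)

namespace Isotopy

/-! ### Operations on isotopies -/

/-- The isotopy `t ↦ γ_{g t}`. -/
def reparam (γ : Ξ.Isotopy) (g : ℝ → ℝ) (hg : ContDiff ℝ ∞ g)
    (hg01 : MapsTo g (Icc 0 1) (Icc 0 1)) : Ξ.Isotopy where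
  map t := γ.map (g t)
  smooth := γ.smooth.comp ((hg.contMDiff.comp_contMDiffOn contMDiffOn_fst).prodMk contMDiffOn_snd)
    fun _ hp => ⟨hg01 hp.1, trivial⟩
  isContactomorphism t ht := γ.isContactomorphism (g t) (hg01 ht)

/-- The isotopy `t ↦ γ_t δ_t`. -/
def mul (γ δ : Ξ.Isotopy) : Ξ.Isotopy where
  map t := γ.map t * δ.map t
  smooth := γ.smooth.comp (contMDiffOn_fst.prodMk δ.smooth) fun _ hp => ⟨hp.1, trivial⟩
  isContactomorphism t ht := (γ.isContactomorphism t ht).mul (δ.isContactomorphism t ht)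

/-- The constant isotopy. -/
def const (φ : Diffeo n M) (hφ : Ξ.IsContactomorphism φ) : Ξ.Isotopy where
  map _ := φ
  smooth := φ.contMDiff.comp_contMDiffOn contMDiffOn_snd
  isContactomorphism _ _ := hφ

theorem hasMFDerivWithinAt_curve (γ : Ξ.Isotopy) {t : ℝ} (ht : t ∈ Icc (0 : ℝ) 1) (x : M) :
    HasMFDerivWithinAt 𝓘(ℝ, ℝ) (𝓡 (2 * n + 1)) (fun s => γ.map s x) (Icc 0 1) t
      (ContinuousLinearMap.toSpanSingleton ℝ (γ.velocity t x) :
        ℝ →L[ℝ] EuclideanSpace ℝ (Fin (2 * n + 1))) := by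
  have h := γ.hasMFDerivWithinAt_comp_curve (c := fun _ => x) (c' := 0) (mapsTo_id _) ht
    (hasDerivWithinAt_id t _)
      ((hasMFDerivWithinAt_const x (Icc (0 : ℝ) 1) t).congr_mfderiv
        (ContinuousLinearMap.ext_ring (smul_zero (1 : ℝ)).symm))
  rw [γ.velocity_eq ht]
  exact h

theorem totalDeriv_apply (γ : Ξ.Isotopy) {t : ℝ} (ht : t ∈ Icc (0 : ℝ) 1) (x : M) (r : ℝ)
    (v : TangentSpace (𝓡 (2 * n + 1)) x) :
    γ.totalDeriv t x (r, v) = r • γ.velocity t x +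
      mfderiv (𝓡 (2 * n + 1)) (𝓡 (2 * n + 1)) (γ.map t) x v := by
  have key : ∀ (L : ℝ × EuclideanSpace ℝ (Fin (2 * n + 1)) →L[ℝ]
      EuclideanSpace ℝ (Fin (2 * n + 1))) (w : EuclideanSpace ℝ (Fin (2 * n + 1))),
      L (r, w) = r • L (1, 0) + L (0, w) := fun L w => by
    rw [← map_smul, ← map_add]; simp
  rw [γ.velocity_eq ht, γ.mfderiv_map_eq ht]
  exact key _ v

theorem velocity_reparam_mul (γ δ : Ξ.Isotopy) {g : ℝ → ℝ} (hg : ContDiff ℝ ∞ g)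
    (hg01 : MapsTo g (Icc 0 1) (Icc 0 1)) {t : ℝ} (ht : t ∈ Icc (0 : ℝ) 1) (x : M) :
    ((γ.reparam g hg hg01).mul δ).velocity t x =
      γ.totalDeriv (g t) (δ.map t x) (deriv g t, δ.velocity t x) := by
  have h := γ.hasMFDerivWithinAt_comp_curve hg01 (hg01 ht)
    (hg.differentiable (by simp) t).hasDerivAt.hasDerivWithinAt (δ.hasMFDerivWithinAt_curve ht x)
  have := h.mfderivWithin ((uniqueDiffOn_Icc one_pos).uniqueMDiffOn t ht)
  exact (congrArg (fun L : ℝ →L[ℝ] EuclideanSpace ℝ (Fin (2 * n + 1)) => L 1) this).trans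
    (one_smul ℝ _)

/-- Chain rule: the time derivative of `γ` contributes through `g'`, and the space derivative of
`γ_{g t}` scales `α` by the conformal factor. The function `g` need not be monotone; running `γ`
backwards is essential later. -/
theorem speed_reparam_mul (hα : Ξ.IsContactForm α) (γ δ : Ξ.Isotopy) {g : ℝ → ℝ}
    (hg : ContDiff ℝ ∞ g) (hg01 : MapsTo g (Icc 0 1) (Icc 0 1)) {t : ℝ} (ht : t ∈ Icc (0 : ℝ) 1)
    (x : M) :
    ((γ.reparam g hg hg01).mul δ).speed α t x = deriv g t * γ.speed α (g t) (δ.map t x)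
      + α.confFactor (γ.map (g t)) (δ.map t x) * δ.speed α t x := by
  have h1 : ((γ.reparam g hg hg01).mul δ).speed α t x =
      α (γ.map (g t) (δ.map t x))
        (γ.totalDeriv (g t) (δ.map t x) (deriv g t, δ.velocity t x)) := by
    rw [speed, velocity_reparam_mul γ δ hg hg01 ht]; rfl
  rw [h1, totalDeriv_apply γ (hg01 ht), map_add, map_smul,
    hα.pullback_apply (γ.isContactomorphism _ (hg01 ht))]
  rfl

theorem speed_const (φ : Diffeo n M) (hφ : Ξ.IsContactomorphism φ) (t : ℝ) (x : M) :
    (const φ hφ).speed α t x = 0 := by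
  have : (const φ hφ).velocity t x = 0 := by
    rw [velocity]
    simp only [const]
    rw [mfderivWithin_const]
    rfl
  rw [speed, this, map_zero]

theorem speed_const_mul (ψ : Diffeo n M) (hψ : Ξ.IsContactomorphism ψ) (γ : Ξ.Isotopy) {t : ℝ}
    (ht : t ∈ Icc (0 : ℝ) 1) (x : M) :
    ((const ψ hψ).mul γ).speed α t x = γ.speed (α.pullback ψ) t x := by
  have h := (ψ.mdifferentiable (by simp) (γ.map t x)).hasMFDerivAt.comp_hasMFDerivWithinAt t
    (γ.hasMFDerivWithinAt_curve ht x)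
  have h2 := h.mfderivWithin ((uniqueDiffOn_Icc one_pos).uniqueMDiffOn t ht)
  have h3 : ((const ψ hψ).mul γ).velocity t x =
      mfderiv (𝓡 (2 * n + 1)) (𝓡 (2 * n + 1)) ψ (γ.map t x) ((1 : ℝ) • γ.velocity t x) :=
    congrArg (fun L : ℝ →L[ℝ] EuclideanSpace ℝ (Fin (2 * n + 1)) => L 1) h2
  rw [one_smul] at h3
  rw [speed, h3]
  rfl

end Isotopy
end CoorientedContactStructure

namespace CoorientedContactStructure
variable {Ξ : CoorientedContactStructure n M} {α : OneForm n M}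
namespace Isotopy

theorem speed_reparam (hα : Ξ.IsContactForm α) (γ : Ξ.Isotopy) {g : ℝ → ℝ}
    (hg : ContDiff ℝ ∞ g) (hg01 : MapsTo g (Icc 0 1) (Icc 0 1)) {t : ℝ} (ht : t ∈ Icc (0 : ℝ) 1)
    (x : M) : (γ.reparam g hg hg01).speed α t x = deriv g t * γ.speed α (g t) x := by
  have h := speed_reparam_mul hα γ (const 1 (IsContactomorphism.one Ξ)) hg hg01 ht x
  rw [speed_const, mul_zero, add_zero] at h
  exact h

theorem speed_mul (hα : Ξ.IsContactForm α) (γ δ : Ξ.Isotopy) {t : ℝ} (ht : t ∈ Icc (0 : ℝ) 1)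
    (x : M) : (γ.mul δ).speed α t x = γ.speed α t (δ.map t x)
      + α.confFactor (γ.map t) (δ.map t x) * δ.speed α t x := by
  have h := speed_reparam_mul hα γ δ contDiff_id (mapsTo_id _) ht x
  rw [deriv_id, one_mul] at h
  exact h

/-- The isotopy `t ↦ γ_t φ`. -/
def mulRight (γ : Ξ.Isotopy) (φ : Ξ.Cont₀) : Ξ.Isotopy :=
  γ.mul (const φ (isContactomorphism_of_mem φ.2))

theorem speed_mulRight (hα : Ξ.IsContactForm α) (γ : Ξ.Isotopy) (φ : Ξ.Cont₀) {t : ℝ}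
    (ht : t ∈ Icc (0 : ℝ) 1) (x : M) :
    (γ.mulRight φ).speed α t x = γ.speed α t ((φ : Diffeo n M) x) := by
  rw [mulRight, speed_mul hα _ _ ht, speed_const, mul_zero, add_zero]
  rfl

@[simp]
theorem mulRight_map (γ : Ξ.Isotopy) (φ : Ξ.Cont₀) (t : ℝ) :
    (γ.mulRight φ).map t = γ.map t * φ := rfl

/-- The piece over `[0, t]`, right-translated by `γ_0⁻¹`, joins the identity to `γ_t γ_0⁻¹`. -/
theorem map_mem (γ : Ξ.Isotopy) (h0 : γ.map 0 ∈ Ξ.Cont₀) {t : ℝ} (ht : t ∈ Icc (0 : ℝ) 1) :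
    γ.map t ∈ Ξ.Cont₀ := by
  let δ := (γ.reparam (fun s => t * s) (contDiff_const.mul contDiff_id)
    fun s hs => ⟨mul_nonneg ht.1 hs.1, mul_le_one₀ ht.2 hs.1 hs.2⟩).mulRight (⟨_, h0⟩ : Ξ.Cont₀)⁻¹
  have h : γ.map t * (γ.map 0)⁻¹ ∈ Ξ.Cont₀ := ⟨δ, by simp [δ, reparam], by simp [δ, reparam]⟩
  simpa using Ξ.Cont₀.mul_mem h h0

/-! ### Positivity and extrema of the contact Hamiltonian -/

theorem isPositive_iff (hα : Ξ.IsContactForm α) (γ : Ξ.Isotopy) :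
    γ.IsPositive ↔ ∀ t ∈ Icc (0 : ℝ) 1, ∀ x, 0 < γ.speed α t x := by
  simp only [IsPositive, hα.mem_pos_iff, speed]

theorem isNonneg_iff (hα : Ξ.IsContactForm α) (γ : Ξ.Isotopy) :
    γ.IsNonneg ↔ ∀ t ∈ Icc (0 : ℝ) 1, ∀ x, 0 ≤ γ.speed α t x := by
  simp only [IsNonneg, hα.mem_pos_iff, hα.mem_ξ_iff, speed, le_iff_lt_or_eq, eq_comm]

theorem IsPositive.isNonneg {γ : Ξ.Isotopy} (h : γ.IsPositive) : γ.IsNonneg :=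
  fun t ht x => .inl (h t ht x)

/-- `min_M α (X_t)`. -/
def minSpeed (γ : Ξ.Isotopy) (α : OneForm n M) (t : ℝ) : ℝ := ⨅ x : M, γ.speed α t x

/-- `max_M |α (X_t)|`. -/
def maxAbsSpeed (γ : Ξ.Isotopy) (α : OneForm n M) (t : ℝ) : ℝ := ⨆ x : M, |γ.speed α t x|

theorem lorentzLength_eq (γ : Ξ.Isotopy) (α : OneForm n M) :
    γ.lorentzLength α = ∫ t in (0 : ℝ)..1, γ.minSpeed α t := rfl

theorem hoferLength_eq (γ : Ξ.Isotopy) (α : OneForm n M) :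
    γ.hoferLength α = ∫ t in (0 : ℝ)..1, γ.maxAbsSpeed α t := rfl

/-- Freezing time outside `[0, 1]` gives a globally continuous function, whose infimum and supremum
over the compact `M` then depend continuously on time. -/
theorem continuous_speed_proj (γ : Ξ.Isotopy) (hα : Ξ.IsContactForm α) :
    Continuous fun p : ℝ × M => γ.speed α (projIcc (0 : ℝ) 1 zero_le_one p.1) p.2 :=
  (γ.continuousOn_speed hα.isContact.smooth).comp_continuous
    (f := fun p : ℝ × M => ((projIcc (0 : ℝ) 1 zero_le_one p.1 : ℝ), p.2))
    ((continuous_subtype_val.comp (continuous_projIcc.comp continuous_fst)).prodMk continuous_snd)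
    fun _ => ⟨Subtype.prop _, trivial⟩

section Compact

variable [CompactSpace M]

theorem continuousOn_minSpeed (γ : Ξ.Isotopy) (hα : Ξ.IsContactForm α) :
    ContinuousOn (γ.minSpeed α) (Icc 0 1) := by
  have h := (isCompact_univ (X := M)).continuous_sInf
    (f := fun t x => γ.speed α (projIcc (0 : ℝ) 1 zero_le_one t) x) (γ.continuous_speed_proj hα)
  refine h.continuousOn.congr fun t ht => ?_
  simp only [image_univ, projIcc_of_mem _ ht]
  rfl

theorem continuousOn_maxAbsSpeed (γ : Ξ.Isotopy) (hα : Ξ.IsContactForm α) :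
    ContinuousOn (γ.maxAbsSpeed α) (Icc 0 1) := by
  have h := (isCompact_univ (X := M)).continuous_sSup
    (f := fun t x => |γ.speed α (projIcc (0 : ℝ) 1 zero_le_one t) x|)
    (γ.continuous_speed_proj hα).abs
  refine h.continuousOn.congr fun t ht => ?_
  simp only [image_univ, projIcc_of_mem _ ht]
  rfl

theorem exists_abs_speed_le (γ : Ξ.Isotopy) (hα : Ξ.IsContactForm α) :
    ∃ K > 0, ∀ t ∈ Icc (0 : ℝ) 1, ∀ x, |γ.speed α t x| ≤ K := by
  obtain ⟨K, hK⟩ := (isCompact_Icc.prod isCompact_univ).exists_bound_of_continuousOn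
    (γ.continuousOn_speed hα.isContact.smooth)
  exact ⟨max K 1, by positivity, fun t ht x => (hK (t, x) ⟨ht, trivial⟩).trans (le_max_left _ _)⟩

theorem minSpeed_le (γ : Ξ.Isotopy) (hα : Ξ.IsContactForm α) {t : ℝ} (ht : t ∈ Icc (0 : ℝ) 1)
    (x : M) : γ.minSpeed α t ≤ γ.speed α t x := by
  obtain ⟨K, -, hK⟩ := γ.exists_abs_speed_le hα
  exact ciInf_le ⟨-K, by rintro _ ⟨y, rfl⟩; exact (abs_le.1 (hK t ht y)).1⟩ x

theorem abs_speed_le_maxAbsSpeed (γ : Ξ.Isotopy) (hα : Ξ.IsContactForm α) {t : ℝ}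
    (ht : t ∈ Icc (0 : ℝ) 1) (x : M) : |γ.speed α t x| ≤ γ.maxAbsSpeed α t := by
  obtain ⟨K, -, hK⟩ := γ.exists_abs_speed_le hα
  exact le_ciSup (f := fun x => |γ.speed α t x|) ⟨K, by rintro _ ⟨y, rfl⟩; exact hK t ht y⟩ x

theorem exists_confFactor_bounds (γ : Ξ.Isotopy) (hα : Ξ.IsContactForm α)
    (h0 : γ.map 0 ∈ Ξ.Cont₀) :
    ∃ a > 0, ∃ b > 0, ∀ t ∈ Icc (0 : ℝ) 1, ∀ x,
      a ≤ α.confFactor (γ.map t) x ∧ α.confFactor (γ.map t) x ≤ b := by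
  have hK := isCompact_Icc (a := (0 : ℝ)) (b := 1) |>.prod (isCompact_univ (X := M))
  have hc := hα.continuousOn_confFactor γ
  have hpos : ∀ p ∈ Icc (0 : ℝ) 1 ×ˢ (univ : Set M), 0 < α.confFactor (γ.map p.1) p.2 :=
    fun p hp => hα.confFactor_pos γ (hα.confFactor_pos_of_mem h0 _) hp.1
  obtain ⟨a, ha, hab⟩ := hK.exists_forall_le' hc hpos
  obtain ⟨b, hb⟩ := hK.exists_bound_of_continuousOn hc
  exact ⟨a, ha, max b 1, by positivity, fun t ht x => ⟨hab (t, x) ⟨ht, trivial⟩,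
    ((le_abs_self _).trans (hb (t, x) ⟨ht, trivial⟩)).trans (le_max_left _ _)⟩⟩

theorem IsPositive.exists_le_speed {γ : Ξ.Isotopy} (hγ : γ.IsPositive)
    (hα : Ξ.IsContactForm α) :
    ∃ k > 0, ∀ t ∈ Icc (0 : ℝ) 1, ∀ x, k ≤ γ.speed α t x := by
  obtain ⟨a, ha, hab⟩ := (isCompact_Icc.prod isCompact_univ).exists_forall_le'
    (γ.continuousOn_speed hα.isContact.smooth)
    fun p hp => (γ.isPositive_iff hα).1 hγ p.1 hp.1 p.2
  exact ⟨a, ha, fun t ht x => hab (t, x) ⟨ht, trivial⟩⟩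

theorem intervalIntegrable_minSpeed (γ : Ξ.Isotopy) (hα : Ξ.IsContactForm α) {a b : ℝ}
    (ha : a ∈ Icc (0 : ℝ) 1) (hb : b ∈ Icc (0 : ℝ) 1) :
    IntervalIntegrable (γ.minSpeed α) MeasureTheory.volume a b :=
  ((γ.continuousOn_minSpeed hα).mono (uIcc_subset_Icc ha hb)).intervalIntegrable

variable [Nonempty M]

theorem le_minSpeed {γ : Ξ.Isotopy} {t c : ℝ} (h : ∀ x, c ≤ γ.speed α t x) :
    c ≤ γ.minSpeed α t := le_ciInf h

theorem isNonneg_iff_minSpeed (hα : Ξ.IsContactForm α) (γ : Ξ.Isotopy) :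
    γ.IsNonneg ↔ ∀ t ∈ Icc (0 : ℝ) 1, 0 ≤ γ.minSpeed α t := by
  rw [isNonneg_iff hα]
  exact ⟨fun h t ht => le_minSpeed (h t ht), fun h t ht x => (h t ht).trans (γ.minSpeed_le hα ht x)⟩

theorem integral_le_lorentzLength (γ : Ξ.Isotopy) (hα : Ξ.IsContactForm α) {c : ℝ → ℝ}
    (hc : ContinuousOn c (Icc 0 1)) (h : ∀ t ∈ Icc (0 : ℝ) 1, ∀ x, c t ≤ γ.speed α t x) :
    ∫ t in (0 : ℝ)..1, c t ≤ γ.lorentzLength α :=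
  intervalIntegral.integral_mono_on zero_le_one
    ((uIcc_of_le (zero_le_one' ℝ)) ▸ hc).intervalIntegrable
    (γ.intervalIntegrable_minSpeed hα (by simp) (by simp))
    fun t ht => le_minSpeed (h t ht)

end Compact
end Isotopy
end CoorientedContactStructure

/-! ### Derivatives of the cut-off function and change of variables -/

theorem deriv_smoothTransition_of_nonpos {x : ℝ} (hx : x ≤ 0) :
    deriv Real.smoothTransition x = 0 :=
  IsLocalMin.deriv_eq_zero <| .of_forall fun y => by
    rw [Real.smoothTransition.zero_of_nonpos hx]; exact Real.smoothTransition.nonneg y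

theorem deriv_smoothTransition_of_one_le {x : ℝ} (hx : 1 ≤ x) :
    deriv Real.smoothTransition x = 0 :=
  IsLocalMax.deriv_eq_zero <| .of_forall fun y => by
    rw [Real.smoothTransition.one_of_one_le hx]; exact Real.smoothTransition.le_one y

theorem integral_deriv_mul_comp {g m : ℝ → ℝ} (hg : ContDiff ℝ ∞ g)
    (hg01 : MapsTo g (Icc 0 1) (Icc 0 1)) (hm : ContinuousOn m (Icc 0 1)) :
    ∫ t in (0 : ℝ)..1, deriv g t * m (g t) = ∫ t in g 0..g 1, m t := by
  have h := intervalIntegral.integral_comp_mul_deriv' (a := 0) (b := 1) (f := g) (f' := deriv g)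
    (g := m) (fun x _ => (hg.differentiable (by simp) x).hasDerivAt)
    (hg.continuous_deriv (by simp)).continuousOn
    (hm.mono (by rw [uIcc_of_le zero_le_one]; exact hg01.image_subset))
  rw [← h]
  simp only [Function.comp, mul_comm]

namespace CoorientedContactStructure
variable {Ξ : CoorientedContactStructure n M} {α : OneForm n M}

/-! ### The Lorentzian distance as a supremum of lengths -/

theorem le_lorentzDist {φ ψ : Ξ.Cont₀} {γ : Ξ.Isotopy} (h0 : γ.map 0 = φ) (h1 : γ.map 1 = ψ)
    (hγ : γ.IsNonneg) : ENNReal.ofReal (γ.lorentzLength α) ≤ Ξ.lorentzDist α φ ψ := by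
  have hc : Ξ.CausalBefore φ ψ := ⟨γ, h0, h1, hγ⟩
  rw [lorentzDist, if_pos hc]
  exact le_sSup ⟨γ, h0, h1, hγ, rfl⟩

theorem exists_of_lt_lorentzDist {φ ψ : Ξ.Cont₀} {c : ℝ≥0∞} (h : c < Ξ.lorentzDist α φ ψ) :
    ∃ γ : Ξ.Isotopy, γ.map 0 = φ ∧ γ.map 1 = ψ ∧ γ.IsNonneg ∧
      c < ENNReal.ofReal (γ.lorentzLength α) := by
  rw [lorentzDist] at h
  split_ifs at h with hc
  · obtain ⟨_, ⟨γ, h0, h1, hγ, rfl⟩, hlt⟩ := lt_sSup_iff.1 h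
    exact ⟨γ, h0, h1, hγ, hlt⟩
  · exact absurd h not_lt_zero

theorem lorentzDist_le {φ ψ : Ξ.Cont₀} {c : ℝ≥0∞}
    (h : ∀ γ : Ξ.Isotopy, γ.map 0 = φ → γ.map 1 = ψ → γ.IsNonneg →
      ENNReal.ofReal (γ.lorentzLength α) ≤ c) : Ξ.lorentzDist α φ ψ ≤ c := by
  by_contra! hlt
  obtain ⟨γ, h0, h1, hγ, hc⟩ := exists_of_lt_lorentzDist hlt
  exact (h γ h0 h1 hγ).not_gt hc

theorem ChronBefore.causalBefore {φ ψ : Ξ.Cont₀} (h : Ξ.ChronBefore φ ψ) : Ξ.CausalBefore φ ψ :=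
  let ⟨γ, h0, h1, hγ⟩ := h
  ⟨γ, h0, h1, hγ.isNonneg⟩

section Compact

variable [CompactSpace M] [Nonempty M]

/-! ### Concatenating, restricting and perturbing non-negative isotopies -/

namespace Isotopy

/-- Concatenation of isotopies, realised as a pointwise product so that no gluing is needed. -/
theorem IsNonneg.exists_concat (hα : Ξ.IsContactForm α) {γ δ : Ξ.Isotopy} (hγ : γ.IsNonneg)
    (hδ : δ.IsNonneg) {ψ : Ξ.Cont₀} (h1 : γ.map 1 = ψ) (h0 : δ.map 0 = ψ) :
    ∃ P : Ξ.Isotopy, P.map 0 = γ.map 0 ∧ P.map 1 = δ.map 1 ∧ P.IsNonneg ∧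
      γ.lorentzLength α + δ.lorentzLength α ≤ P.lorentzLength α := by
  let g : ℝ → ℝ := fun t => Real.smoothTransition (2 * t)
  let h : ℝ → ℝ := fun t => Real.smoothTransition (2 * t - 1)
  have hg : ContDiff ℝ ∞ g := Real.smoothTransition.contDiff.comp (contDiff_const.mul contDiff_id)
  have hh : ContDiff ℝ ∞ h := Real.smoothTransition.contDiff.comp
    ((contDiff_const.mul contDiff_id).sub contDiff_const)
  have hg01 : MapsTo g (Icc 0 1) (Icc 0 1) := fun t _ =>
    ⟨Real.smoothTransition.nonneg _, Real.smoothTransition.le_one _⟩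
  have hh01 : MapsTo h (Icc 0 1) (Icc 0 1) := fun t _ =>
    ⟨Real.smoothTransition.nonneg _, Real.smoothTransition.le_one _⟩
  have hg0 : g 0 = 0 := by simp [g, Real.smoothTransition.zero]
  have hh0 : h 0 = 0 := Real.smoothTransition.zero_of_nonpos (by norm_num)
  have hg1 : g 1 = 1 := Real.smoothTransition.one_of_one_le (by norm_num)
  have hh1 : h 1 = 1 := Real.smoothTransition.one_of_one_le (by norm_num)
  have hg' : ∀ t, 0 ≤ deriv g t := fun t => Monotone.deriv_nonneg
    (Real.smoothTransition.monotone.comp fun x y hxy => by linarith)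
  have hh' : ∀ t, 0 ≤ deriv h t := fun t => Monotone.deriv_nonneg
    (Real.smoothTransition.monotone.comp fun x y hxy => by linarith)
  -- `g` climbs during the first half and `h` during the second.
  have hgz : ∀ t, h t ≠ 0 → deriv g t = 0 := fun t ht => by
    have : 1 ≤ 2 * t := by
      by_contra! hlt
      exact ht (Real.smoothTransition.zero_of_nonpos (by linarith))
    refine IsLocalMax.deriv_eq_zero (.of_forall fun y => ?_)
    change Real.smoothTransition _ ≤ Real.smoothTransition _
    rw [Real.smoothTransition.one_of_one_le this]
    exact Real.smoothTransition.le_one _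
  let P := ((δ.mulRight ψ⁻¹).reparam h hh hh01).mul (γ.reparam g hg hg01)
  have hP : ∀ t ∈ Icc (0 : ℝ) 1, ∀ x,
      deriv g t * γ.minSpeed α (g t) + deriv h t * δ.minSpeed α (h t) ≤ P.speed α t x := by
    intro t ht x
    rw [speed_reparam_mul hα _ _ hh hh01 ht, speed_mulRight hα _ _ (hh01 ht),
      speed_reparam hα _ hg hg01 ht]
    -- No length is lost to the conformal factor: while `γ` moves, the left factor is still the
    -- identity.
    have e : α.confFactor ((δ.mulRight ψ⁻¹).map (h t)) ((γ.reparam g hg hg01).map t x) *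
        (deriv g t * γ.speed α (g t) x) = deriv g t * γ.speed α (g t) x := by
      by_cases hz : h t = 0
      · have : (δ.mulRight ψ⁻¹).map (h t) = 1 := by simp [hz, h0]
        rw [this, hα.confFactor_one, one_mul]
      · rw [hgz t hz]; ring
    rw [e, add_comm]
    exact add_le_add
      (mul_le_mul_of_nonneg_left (δ.minSpeed_le hα (hh01 ht) _) (hh' t))
      (mul_le_mul_of_nonneg_left (γ.minSpeed_le hα (hg01 ht) _) (hg' t))
  have hcg : ContinuousOn (fun t => deriv g t * γ.minSpeed α (g t)) (Icc 0 1) :=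
    (hg.continuous_deriv (by simp)).continuousOn.mul
      ((γ.continuousOn_minSpeed hα).comp hg.continuous.continuousOn hg01)
  have hch : ContinuousOn (fun t => deriv h t * δ.minSpeed α (h t)) (Icc 0 1) :=
    (hh.continuous_deriv (by simp)).continuousOn.mul
      ((δ.continuousOn_minSpeed hα).comp hh.continuous.continuousOn hh01)
  refine ⟨P, ?_, ?_, ?_, ?_⟩
  · simp [P, mul, reparam, hg0, hh0, h0]
  · simp [P, mul, reparam, hg1, hh1, h1]
  · rw [isNonneg_iff hα]
    refine fun t ht x => le_trans ?_ (hP t ht x)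
    exact add_nonneg
      (mul_nonneg (hg' t) ((isNonneg_iff_minSpeed hα γ).1 hγ _ (hg01 ht)))
      (mul_nonneg (hh' t) ((isNonneg_iff_minSpeed hα δ).1 hδ _ (hh01 ht)))
  · refine le_trans (le_of_eq ?_) (P.integral_le_lorentzLength hα (hcg.add hch) hP)
    have hu := uIcc_of_le (zero_le_one' ℝ)
    simp only [Pi.add_apply]
    rw [intervalIntegral.integral_add (hu ▸ hcg).intervalIntegrable
      (hu ▸ hch).intervalIntegrable, integral_deriv_mul_comp hg hg01 (γ.continuousOn_minSpeed hα),
      integral_deriv_mul_comp hh hh01 (δ.continuousOn_minSpeed hα), hg0, hg1, hh0, hh1]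
    rfl

theorem lorentzLength_nonneg {γ : Ξ.Isotopy} (hα : Ξ.IsContactForm α) (hγ : γ.IsNonneg) :
    0 ≤ γ.lorentzLength α :=
  intervalIntegral.integral_nonneg zero_le_one ((isNonneg_iff_minSpeed hα γ).1 hγ)

theorem IsPositive.lorentzLength_pos {γ : Ξ.Isotopy} (hα : Ξ.IsContactForm α)
    (hγ : γ.IsPositive) : 0 < γ.lorentzLength α := by
  obtain ⟨k, hk, h⟩ := hγ.exists_le_speed hα
  have := γ.integral_le_lorentzLength hα (c := fun _ => k) continuousOn_const h
  simp only [intervalIntegral.integral_const, sub_zero, one_smul] at this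
  exact hk.trans_le this

/-- A piece `(γ_t)`, `a ≤ t ≤ b`, of a non-negative isotopy, reparametrised over `[0, 1]`. -/
theorem IsNonneg.exists_restrict (hα : Ξ.IsContactForm α) {γ : Ξ.Isotopy} (hγ : γ.IsNonneg)
    {a b : ℝ} (ha : 0 ≤ a) (hab : a ≤ b) (hb : b ≤ 1) :
    ∃ P : Ξ.Isotopy, P.map 0 = γ.map a ∧ P.map 1 = γ.map b ∧ P.IsNonneg ∧
      ∫ t in a..b, γ.minSpeed α t ≤ P.lorentzLength α := by
  let g : ℝ → ℝ := fun t => a + (b - a) * t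
  have hg : ContDiff ℝ ∞ g := contDiff_const.add (contDiff_const.mul contDiff_id)
  have hg01 : MapsTo g (Icc 0 1) (Icc 0 1) := fun t ht =>
    ⟨by simp only [g]; nlinarith [ht.1], by simp only [g]; nlinarith [ht.2]⟩
  have hd : ∀ t, deriv g t = b - a := fun t => by simp [g]
  have hP : ∀ t ∈ Icc (0 : ℝ) 1, ∀ x,
      deriv g t * γ.minSpeed α (g t) ≤ (γ.reparam g hg hg01).speed α t x := fun t ht x => by
    rw [speed_reparam hα _ hg hg01 ht]
    exact mul_le_mul_of_nonneg_left (γ.minSpeed_le hα (hg01 ht) _) (by rw [hd]; linarith)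
  refine ⟨γ.reparam g hg hg01, by simp [reparam, g], by simp [reparam, g], ?_, ?_⟩
  · rw [isNonneg_iff hα]
    refine fun t ht x => le_trans ?_ (hP t ht x)
    exact mul_nonneg (by rw [hd]; linarith) ((isNonneg_iff_minSpeed hα γ).1 hγ _ (hg01 ht))
  · refine le_trans (le_of_eq ?_) (integral_le_lorentzLength _ hα
      ((hg.continuous_deriv (by simp)).continuousOn.mul
        ((γ.continuousOn_minSpeed hα).comp hg.continuous.continuousOn hg01)) hP)
    simp only [Pi.mul_apply, Function.comp]
    rw [integral_deriv_mul_comp hg hg01 (γ.continuousOn_minSpeed hα)]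
    simp [g]

/-- Near some time `c` the minimal speed is at least `k > 0`. Left multiplication by the loop `η_{g
t}`, where `η = γ γ_c⁻¹` and `g` stays near `c` with `g 0 = g 1 = c`, keeps the end points. Away
from `c`, `g` advances at rate `ε` and adds positive speed; near `c` it must go back, and the
positivity of `γ` there absorbs the loss. -/
theorem IsNonneg.exists_isPositive (hα : Ξ.IsContactForm α) {γ : Ξ.Isotopy} (hγ : γ.IsNonneg)
    (h0 : γ.map 0 ∈ Ξ.Cont₀) (hlen : 0 < γ.lorentzLength α) :
    ∃ P : Ξ.Isotopy, P.map 0 = γ.map 0 ∧ P.map 1 = γ.map 1 ∧ P.IsPositive := by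
  have hmc := γ.continuousOn_minSpeed hα
  obtain ⟨c, hc, hmpos⟩ : ∃ c ∈ Ioo (0 : ℝ) 1, 0 < γ.minSpeed α c := by
    by_contra! hneg
    have := intervalIntegral.integral_mono_on_of_le_Ioo zero_le_one
      (γ.intervalIntegrable_minSpeed hα (a := 0) (b := 1) (by simp) (by simp))
      (intervalIntegrable_const (c := (0 : ℝ))) hneg
    rw [intervalIntegral.integral_zero] at this
    exact hlen.not_ge this
  obtain ⟨r, hr, hsub⟩ : ∃ r > 0, Icc (c - r) (c + r) ⊆ Ioo 0 1 ∩ {t | 0 < γ.minSpeed α t} := by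
    have hn : Ioo 0 1 ∩ {t | 0 < γ.minSpeed α t} ∈ 𝓝 c :=
      inter_mem (Ioo_mem_nhds hc.1 hc.2)
        ((hmc.continuousAt (Icc_mem_nhds hc.1 hc.2)).eventually (lt_mem_nhds hmpos))
    obtain ⟨r, hr, h⟩ := Metric.nhds_basis_closedBall.mem_iff.1 hn
    exact ⟨r, hr, by rwa [← Real.closedBall_eq_Icc]⟩
  have hI : Icc (c - r) (c + r) ⊆ Icc 0 1 := fun t ht => Ioo_subset_Icc_self (hsub ht).1
  obtain ⟨k, hk, hkm⟩ := isCompact_Icc.exists_forall_le' (hmc.mono hI) fun t ht => (hsub ht).2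
  obtain ⟨K, hK, hKs⟩ := γ.exists_abs_speed_le hα
  have hc01 := Ioo_subset_Icc_self hc
  let ψ : Ξ.Cont₀ := ⟨γ.map c, γ.map_mem h0 hc01⟩
  let η := γ.mulRight ψ⁻¹
  obtain ⟨ρ, hρ, _, -, hρη⟩ := η.exists_confFactor_bounds hα (Ξ.Cont₀.mul_mem h0 (ψ⁻¹).2)
  -- Slope `1` off `[c - r, c + r]`, with the unit step inside that interval bringing `h` back to
  -- `0` at time `1`.
  let h : ℝ → ℝ := fun t => t - Real.smoothTransition ((t - (c - r)) / (2 * r))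
  have hh : ContDiff ℝ ∞ h := contDiff_id.sub (Real.smoothTransition.contDiff.comp
    ((contDiff_id.sub contDiff_const).div_const _))
  obtain ⟨H, hH⟩ := isCompact_Icc (a := (0 : ℝ)) (b := 1) |>.exists_bound_of_continuousOn
    (hh.continuous_deriv (by simp)).continuousOn
  have hc0 : 0 < c - r := (hsub (left_mem_Icc.2 (by linarith))).1.1
  have hc1 : c + r < 1 := (hsub (right_mem_Icc.2 (by linarith))).1.2
  have hh0 : h 0 = 0 := by
    have : Real.smoothTransition ((0 - (c - r)) / (2 * r)) = 0 :=
      Real.smoothTransition.zero_of_nonpos (div_nonpos_of_nonpos_of_nonneg (by linarith)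
        (by linarith))
    simp only [h, this, sub_zero]
  have hh1 : h 1 = 0 := by
    have : Real.smoothTransition ((1 - (c - r)) / (2 * r)) = 1 :=
      Real.smoothTransition.one_of_one_le ((one_le_div (by linarith)).2 (by linarith))
    simp only [h, this, sub_self]
  have habs : ∀ t ∈ Icc (0 : ℝ) 1, |h t| ≤ 1 := fun t ht => by
    have h1 := Real.smoothTransition.nonneg ((t - (c - r)) / (2 * r))
    have h2 := Real.smoothTransition.le_one ((t - (c - r)) / (2 * r))
    rw [abs_le]
    exact ⟨by simp only [h]; linarith [ht.1], by simp only [h]; linarith [ht.2]⟩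
  have hout : ∀ t, t ∉ Icc (c - r) (c + r) → deriv h t = 1 := fun t ht => by
    have hd : HasDerivAt (fun t => (t - (c - r)) / (2 * r)) (1 / (2 * r)) t :=
      ((hasDerivAt_id t).sub_const _).div_const _
    have hs : DifferentiableAt ℝ Real.smoothTransition ((t - (c - r)) / (2 * r)) :=
      (Real.smoothTransition.contDiff (n := 1)).differentiable (by simp) _
    have hz : deriv Real.smoothTransition ((t - (c - r)) / (2 * r)) = 0 := by
      rcases le_or_gt (c - r) t with hle | hlt
      · refine deriv_smoothTransition_of_one_le ((one_le_div (by linarith)).2 ?_)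
        have : c + r < t := by
          by_contra! hle'
          exact ht ⟨hle, hle'⟩
        linarith
      · exact deriv_smoothTransition_of_nonpos (div_nonpos_of_nonpos_of_nonneg (by linarith)
          (by linarith))
    have := ((hasDerivAt_id t).sub (hs.hasDerivAt.comp t hd)).deriv
    rw [hz, zero_mul, sub_zero] at this
    exact this
  have hH0 : 0 ≤ H := (norm_nonneg _).trans (hH 0 (by simp))
  -- `ε ≤ r` keeps `g` where the minimal speed is at least `k`. Going back costs at most `ε H K`,
  -- while `γ` supplies at least `ρ k`. The `+ 1` below makes this comparison strict.
  obtain ⟨ε, hε, hεr, hεk⟩ : ∃ ε > 0, ε ≤ r ∧ ε * H * K < ρ * k := by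
    have hp : 0 < ρ * k / (H * K + 1) := by positivity
    refine ⟨min r (ρ * k / (H * K + 1)), lt_min hr hp, min_le_left _ _, ?_⟩
    have h1 : min r (ρ * k / (H * K + 1)) * (H * K + 1) ≤ ρ * k :=
      (le_div_iff₀ (by positivity)).1 (min_le_right _ _)
    have h2 : 0 < min r (ρ * k / (H * K + 1)) := lt_min hr hp
    nlinarith
  let g : ℝ → ℝ := fun t => c + ε * h t
  have hg : ContDiff ℝ ∞ g := contDiff_const.add (contDiff_const.mul hh)
  have hgd : ∀ t, deriv g t = ε * deriv h t := fun t => by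
    simp only [g, deriv_const_add, deriv_const_mul_field]
  have hgr : MapsTo g (Icc 0 1) (Icc (c - r) (c + r)) := fun t ht => by
    have h1 := abs_le.1 (habs t ht)
    exact ⟨by simp only [g]; nlinarith, by simp only [g]; nlinarith⟩
  have hg01 : MapsTo g (Icc 0 1) (Icc 0 1) := fun t ht => hI (hgr ht)
  refine ⟨(η.reparam g hg hg01).mul γ, ?_, ?_, ?_⟩
  · simp [mul, reparam, g, hh0, η, ψ]
  · simp [mul, reparam, g, hh1, η, ψ]
  · rw [isPositive_iff hα]
    intro t ht x
    rw [speed_reparam_mul hα _ _ hg hg01 ht, speed_mulRight hα _ _ (hg01 ht), hgd]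
    set y := ((ψ⁻¹ : Ξ.Cont₀) : Diffeo n M) (γ.map t x)
    have hy1 : k ≤ γ.speed α (g t) y := (hkm _ (hgr ht)).trans (γ.minSpeed_le hα (hg01 ht) _)
    have hy2 : γ.speed α (g t) y ≤ K := (le_abs_self _).trans (hKs _ (hg01 ht) _)
    have hρ' := (hρη (g t) (hg01 ht) (γ.map t x)).1
    by_cases htI : t ∈ Icc (c - r) (c + r)
    · have hs : k ≤ γ.speed α t x := (hkm _ htI).trans (γ.minSpeed_le hα ht _)
      have h1 : ρ * k ≤ α.confFactor (η.map (g t)) (γ.map t x) * γ.speed α t x :=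
        mul_le_mul hρ' hs hk.le (hρ.le.trans hρ')
      have h2 : |ε * deriv h t * γ.speed α (g t) y| ≤ ε * H * K := by
        rw [abs_mul, abs_mul, abs_of_pos hε]
        exact mul_le_mul (mul_le_mul_of_nonneg_left (hH t ht) hε.le) (hKs _ (hg01 ht) _)
          (abs_nonneg _) (by positivity)
      linarith [(abs_le.1 h2).1]
    · rw [hout t htI, mul_one]
      exact add_pos_of_pos_of_nonneg (mul_pos hε (hk.trans_le hy1))
        (mul_nonneg (hρ.le.trans hρ') ((isNonneg_iff hα γ).1 hγ t ht x))

end Isotopy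

/-! ### Reverse triangle inequality and the chronological relation -/

theorem CausalBefore.trans (hα : Ξ.IsContactForm α) {φ ψ χ : Ξ.Cont₀}
    (h1 : Ξ.CausalBefore φ ψ) (h2 : Ξ.CausalBefore ψ χ) : Ξ.CausalBefore φ χ := by
  obtain ⟨γ, hγ0, hγ1, hγ⟩ := h1
  obtain ⟨δ, hδ0, hδ1, hδ⟩ := h2
  obtain ⟨P, hP0, hP1, hP, -⟩ := hγ.exists_concat hα hδ hγ1 hδ0
  exact ⟨P, hP0.trans hγ0, hP1.trans hδ1, hP⟩

/-- The reverse triangle inequality. -/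
theorem IsContactForm.add_lorentzDist_le (hα : Ξ.IsContactForm α) {φ₁ ψ φ₂ : Ξ.Cont₀}
    (h1 : Ξ.CausalBefore φ₁ ψ) (h2 : Ξ.CausalBefore ψ φ₂) :
    Ξ.lorentzDist α φ₁ ψ + Ξ.lorentzDist α ψ φ₂ ≤ Ξ.lorentzDist α φ₁ φ₂ := by
  rw [lorentzDist, if_pos h1, lorentzDist, if_pos h2, sSup_eq_iSup, sSup_eq_iSup]
  obtain ⟨γ₀, hγ₀⟩ := h1
  obtain ⟨δ₀, hδ₀⟩ := h2
  refine ENNReal.biSup_add_biSup_le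
    (s := {ℓ | ∃ γ : Ξ.Isotopy, γ.map 0 = φ₁ ∧ γ.map 1 = ψ ∧ γ.IsNonneg ∧
      ℓ = ENNReal.ofReal (γ.lorentzLength α)})
    (t := {ℓ | ∃ γ : Ξ.Isotopy, γ.map 0 = ψ ∧ γ.map 1 = φ₂ ∧ γ.IsNonneg ∧
      ℓ = ENNReal.ofReal (γ.lorentzLength α)})
    ⟨_, γ₀, hγ₀.1, hγ₀.2.1, hγ₀.2.2, rfl⟩ ⟨_, δ₀, hδ₀.1, hδ₀.2.1, hδ₀.2.2, rfl⟩ ?_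
  rintro _ ⟨γ, hγ0, hγ1, hγ, rfl⟩ _ ⟨δ, hδ0, hδ1, hδ, rfl⟩
  obtain ⟨P, hP0, hP1, hP, hlen⟩ := hγ.exists_concat hα hδ hγ1 hδ0
  rw [← ENNReal.ofReal_add (Isotopy.lorentzLength_nonneg hα hγ)
    (Isotopy.lorentzLength_nonneg hα hδ)]
  exact (ENNReal.ofReal_le_ofReal hlen).trans
    (le_lorentzDist (hP0.trans hγ0) (hP1.trans hδ1) hP)

theorem IsContactForm.lorentzDist_pos_iff (hα : Ξ.IsContactForm α) {φ ψ : Ξ.Cont₀} :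
    0 < Ξ.lorentzDist α φ ψ ↔ Ξ.ChronBefore φ ψ := by
  constructor
  · intro h
    obtain ⟨γ, h0, h1, hγ, hlen⟩ := exists_of_lt_lorentzDist h
    obtain ⟨P, hP0, hP1, hP⟩ := hγ.exists_isPositive hα (h0 ▸ φ.2) (ENNReal.ofReal_pos.1 hlen)
    exact ⟨P, hP0.trans h0, hP1.trans h1, hP⟩
  · rintro ⟨γ, h0, h1, hγ⟩
    exact (ENNReal.ofReal_pos.2 (hγ.lorentzLength_pos hα)).trans_le
      (le_lorentzDist h0 h1 hγ.isNonneg)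

theorem Isotopy.IsNonneg.integral_le_lorentzDist (hα : Ξ.IsContactForm α) {γ : Ξ.Isotopy}
    (hγ : γ.IsNonneg) {a b : ℝ} (ha : 0 ≤ a) (hab : a ≤ b) (hb : b ≤ 1) {φ ψ : Ξ.Cont₀}
    (hφ : γ.map a = φ) (hψ : γ.map b = ψ) :
    ENNReal.ofReal (∫ t in a..b, γ.minSpeed α t) ≤ Ξ.lorentzDist α φ ψ := by
  obtain ⟨P, hP0, hP1, hP, hlen⟩ := hγ.exists_restrict hα ha hab hb
  exact (ENNReal.ofReal_le_ofReal hlen).trans (le_lorentzDist (hP0.trans hφ) (hP1.trans hψ) hP)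

end Compact

/-! ### Left translation and pullback of the contact form -/

/-- Left multiplication by an element of `Cont₀`. -/
def Isotopy.mulLeft (ψ : Ξ.Cont₀) (γ : Ξ.Isotopy) : Ξ.Isotopy :=
  (Isotopy.const (ψ : Diffeo n M) (isContactomorphism_of_mem ψ.2)).mul γ

theorem Isotopy.IsNonneg.mulLeft (hα : Ξ.IsContactForm α) {γ : Ξ.Isotopy} (hγ : γ.IsNonneg)
    (ψ : Ξ.Cont₀) : (γ.mulLeft ψ).IsNonneg := by
  rw [Isotopy.isNonneg_iff hα] at hγ ⊢
  intro t ht x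
  rw [Isotopy.mulLeft, Isotopy.speed_mul hα _ _ ht, Isotopy.speed_const, zero_add]
  exact mul_nonneg (hα.confFactor_pos_of_mem ψ.2 _).le (hγ t ht x)

theorem Isotopy.lorentzLength_mulLeft (ψ : Ξ.Cont₀) (γ : Ξ.Isotopy) :
    (γ.mulLeft ψ).lorentzLength α = γ.lorentzLength (α.pullback (ψ : Diffeo n M)) := by
  rw [Isotopy.lorentzLength_eq, Isotopy.lorentzLength_eq]
  refine intervalIntegral.integral_congr fun t ht => ?_
  rw [uIcc_of_le zero_le_one] at ht
  exact iInf_congr fun x => Isotopy.speed_const_mul _ _ γ ht x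

/-- Left translation by `ψ` is a bijection between the isotopies admitted on the two sides and
matches their lengths. Non-negativity refers only to `Ξ`, so `ψ^*α` never has to be recognised as a
contact form. -/
theorem IsContactForm.lorentzDist_mul_left (hα : Ξ.IsContactForm α) (ψ φ₁ φ₂ : Ξ.Cont₀) :
    Ξ.lorentzDist α (ψ * φ₁) (ψ * φ₂) = Ξ.lorentzDist (α.pullback (ψ : Diffeo n M)) φ₁ φ₂ := by
  apply le_antisymm
  · refine lorentzDist_le fun γ h0 h1 hγ => ?_
    have hr : (γ.mulLeft ψ⁻¹).mulLeft ψ = γ := by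
      have : ∀ t, ((γ.mulLeft ψ⁻¹).mulLeft ψ).map t = γ.map t := fun t =>
        mul_inv_cancel_left (ψ : Diffeo n M) (γ.map t)
      cases γ
      simp only [Isotopy.mulLeft, Isotopy.mul, Isotopy.const] at this ⊢
      congr
      exact funext this
    rw [← hr, Isotopy.lorentzLength_mulLeft]
    refine le_lorentzDist ?_ ?_ (hγ.mulLeft hα ψ⁻¹)
    · change ((ψ⁻¹ : Ξ.Cont₀) : Diffeo n M) * γ.map 0 = φ₁
      simp [h0]
    · change ((ψ⁻¹ : Ξ.Cont₀) : Diffeo n M) * γ.map 1 = φ₂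
      simp [h1]
  · refine lorentzDist_le fun γ h0 h1 hγ => ?_
    rw [← Isotopy.lorentzLength_mulLeft]
    refine le_lorentzDist ?_ ?_ (hγ.mulLeft hα ψ)
    · exact congrArg ((ψ : Diffeo n M) * ·) h0
    · exact congrArg ((ψ : Diffeo n M) * ·) h1

end CoorientedContactStructure

/-! ### Smooth functions of one variable -/

/-- A non-negative continuous function on `[0, 1]` is approximated from below by non-negative
smooth functions. -/
theorem exists_contDiff_le {m : ℝ → ℝ} (hm : ContinuousOn m (Icc 0 1))
    (hm0 : ∀ t ∈ Icc (0 : ℝ) 1, 0 ≤ m t) {θ : ℝ} (hθ : 0 < θ) :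
    ∃ q : ℝ → ℝ, ContDiff ℝ ∞ q ∧ ∀ t ∈ Icc (0 : ℝ) 1, 0 ≤ q t ∧ q t ≤ m t ∧ m t - θ ≤ q t := by
  let f : ℝ → ℝ := fun t => m (projIcc (0 : ℝ) 1 zero_le_one t)
  have hf : Continuous f := hm.comp_continuous
    (continuous_subtype_val.comp continuous_projIcc) fun t => Subtype.prop _
  have hf0 : ∀ t, 0 ≤ f t := fun t => hm0 _ (Subtype.prop _)
  obtain ⟨q, hq⟩ := exists_contMDiffMap_forall_mem_convex_of_local_const 𝓘(ℝ, ℝ) (n := (⊤ : ℕ∞))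
    (t := fun t => Icc (max 0 (f t - θ)) (f t)) (fun t => convex_Icc _ _) (fun t => by
      refine ⟨max 0 (f t - θ / 2), ?_⟩
      filter_upwards [hf.continuousAt.eventually (Metric.ball_mem_nhds (f t) (half_pos hθ))]
        with y hy
      rw [Real.dist_eq, abs_lt] at hy
      exact ⟨max_le_max le_rfl (by linarith [hy.2]), max_le (hf0 y) (by linarith [hy.1])⟩)
  refine ⟨q, q.contMDiff.contDiff, fun t ht => ?_⟩
  have h := hq t
  simp only [f, projIcc_of_mem _ ht] at h
  exact ⟨(le_max_left _ _).trans h.1, h.2, (le_max_right _ _).trans h.1⟩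

theorem exists_contDiff_gt {c : ℝ → ℝ} (hc : ContinuousOn c (Icc 0 1)) {θ : ℝ} (hθ : 0 < θ) :
    ∃ q : ℝ → ℝ, ContDiff ℝ ∞ q ∧ ∀ t ∈ Icc (0 : ℝ) 1, c t < q t ∧ q t ≤ c t + θ := by
  obtain ⟨C, hC⟩ := isCompact_Icc.exists_bound_of_continuousOn hc
  -- The shift by `C + θ` makes the function non-negative. Undoing only `C` leaves a value between
  -- `c + θ / 2` and `c + θ`.
  obtain ⟨q, hq, h⟩ := exists_contDiff_le (m := fun t => c t + (C + θ))
    (hc.add continuousOn_const)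
    (fun t ht => by linarith [(abs_le.1 (hC t ht)).1]) (half_pos hθ)
  refine ⟨fun t => q t - C, hq.sub contDiff_const, fun t ht => ?_⟩
  obtain ⟨-, h2, h3⟩ := h t ht
  exact ⟨by linarith, by linarith⟩

theorem exists_contDiff_primitive {q : ℝ → ℝ} (hq : ContDiff ℝ ∞ q) :
    ContDiff ℝ ∞ (fun t => ∫ s in (0 : ℝ)..t, q s) ∧
      ∀ t, HasDerivAt (fun t => ∫ s in (0 : ℝ)..t, q s) (q t) t := by
  have h : ∀ t, HasDerivAt (fun t => ∫ s in (0 : ℝ)..t, q s) (q t) t := fun t =>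
    intervalIntegral.integral_hasDerivAt_right (hq.continuous.intervalIntegrable _ _)
      hq.continuous.stronglyMeasurable.stronglyMeasurableAtFilter hq.continuous.continuousAt
  refine ⟨contDiff_infty_iff_deriv.2 ⟨fun t => (h t).differentiableAt, ?_⟩, h⟩
  rwa [funext fun t => (h t).deriv]

theorem integral_mem_Icc_of_nonneg {q : ℝ → ℝ} (hq : Continuous q)
    (hq0 : ∀ t ∈ Icc (0 : ℝ) 1, 0 ≤ q t) {t : ℝ} (ht : t ∈ Icc (0 : ℝ) 1) :
    ∫ s in (0 : ℝ)..t, q s ∈ Icc 0 (∫ s in (0 : ℝ)..1, q s) := by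
  have h1 : 0 ≤ ∫ s in (0 : ℝ)..t, q s :=
    intervalIntegral.integral_nonneg ht.1 fun s hs => hq0 s ⟨hs.1, hs.2.trans ht.2⟩
  have h2 : 0 ≤ ∫ s in t..1, q s :=
    intervalIntegral.integral_nonneg ht.2 fun s hs => hq0 s ⟨ht.1.trans hs.1, hs.2⟩
  have h3 := intervalIntegral.integral_add_adjacent_intervals
    (hq.intervalIntegrable (μ := MeasureTheory.volume) 0 t) (hq.intervalIntegrable t 1)
  exact ⟨h1, by linarith⟩

namespace CoorientedContactStructure
variable {Ξ : CoorientedContactStructure n M} {α : OneForm n M}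
variable [CompactSpace M] [Nonempty M]

/-! ### Positive isotopies through arbitrary elements -/

namespace Isotopy

theorem IsPositive.mulRight (hα : Ξ.IsContactForm α) {γ : Ξ.Isotopy} (hγ : γ.IsPositive)
    (φ : Ξ.Cont₀) : (γ.mulRight φ).IsPositive := by
  rw [isPositive_iff hα] at hγ ⊢
  intro t ht x
  rw [speed_mulRight hα _ _ ht]
  exact hγ t ht _

/-- The piece over `[a, b]` has positive length, so `lorentzDist_pos_iff` applies. -/
theorem IsPositive.chronBefore (hα : Ξ.IsContactForm α) {γ : Ξ.Isotopy} (hγ : γ.IsPositive)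
    {a b : ℝ} (ha : 0 ≤ a) (hab : a < b) (hb : b ≤ 1) {φ ψ : Ξ.Cont₀} (hφ : γ.map a = φ)
    (hψ : γ.map b = ψ) : Ξ.ChronBefore φ ψ := by
  obtain ⟨k, hk, hks⟩ := hγ.exists_le_speed hα
  rw [← hα.lorentzDist_pos_iff]
  refine lt_of_lt_of_le (ENNReal.ofReal_pos.2 ?_)
    (hγ.isNonneg.integral_le_lorentzDist hα ha hab.le hb hφ hψ)
  refine intervalIntegral.intervalIntegral_pos_of_pos_on
    (γ.intervalIntegrable_minSpeed hα ⟨ha, hab.le.trans hb⟩ ⟨ha.trans hab.le, hb⟩)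
    (fun t ht => hk.trans_le (le_minSpeed (hks t ⟨ha.trans ht.1.le, ht.2.le.trans hb⟩))) hab

/-- Right translates of one positive isotopy can be made to start or end at `κ`. This is what makes
single pasts and futures open, although the topology is generated by their intersections. -/
theorem IsPositive.exists_chronBefore (hα : Ξ.IsContactForm α) {γ : Ξ.Isotopy}
    (hγ : γ.IsPositive) (h0 : γ.map 0 ∈ Ξ.Cont₀) (κ : Ξ.Cont₀) :
    (∃ φ, Ξ.ChronBefore φ κ) ∧ ∃ φ, Ξ.ChronBefore κ φ := by
  let φ₀ : Ξ.Cont₀ := ⟨γ.map 0, h0⟩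
  let φ₁ : Ξ.Cont₀ := ⟨γ.map 1, γ.map_mem h0 (by simp)⟩
  refine ⟨⟨φ₀ * (φ₁⁻¹ * κ), γ.mulRight (φ₁⁻¹ * κ), ?_, ?_, hγ.mulRight hα _⟩,
    ⟨φ₁ * (φ₀⁻¹ * κ), γ.mulRight (φ₀⁻¹ * κ), ?_, ?_, hγ.mulRight hα _⟩⟩ <;> simp [φ₀, φ₁]

end Isotopy

/-! ### Continuity for the interval topology -/

/-- Lower semicontinuity: of an isotopy of length `L > c`, cut off an initial and a final piece of
length `(L - c) / 3` each. They have positive length, so (i) makes them chronological, and the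
middle piece is still longer than `c`. -/
theorem exists_chronBefore_of_lt_lorentzDist (hα : Ξ.IsContactForm α) {φ ψ : Ξ.Cont₀} {c : ℝ≥0∞}
    (hc : c < Ξ.lorentzDist α φ ψ) :
    ∃ φ' ψ', Ξ.ChronBefore φ φ' ∧ Ξ.ChronBefore ψ' ψ ∧ c < Ξ.lorentzDist α φ' ψ' := by
  obtain ⟨γ, h0, h1, hγ, hlt⟩ := exists_of_lt_lorentzDist hc
  have h0mem : γ.map 0 ∈ Ξ.Cont₀ := h0 ▸ φ.2
  lift c to NNReal using (hlt.trans_le le_top).ne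
  set L := γ.lorentzLength α
  have hcL : (c : ℝ) < L := by
    have := ENNReal.toReal_strict_mono ENNReal.ofReal_ne_top hlt
    rwa [ENNReal.toReal_ofReal (Isotopy.lorentzLength_nonneg hα hγ)] at this
  have hint : ∀ {a b : ℝ}, a ∈ Icc (0 : ℝ) 1 → b ∈ Icc (0 : ℝ) 1 →
      IntervalIntegrable (γ.minSpeed α) MeasureTheory.volume a b :=
    fun ha hb => γ.intervalIntegrable_minSpeed hα ha hb
  have hm0 := (Isotopy.isNonneg_iff_minSpeed hα γ).1 hγ
  have z01 : (0 : ℝ) ∈ Icc (0 : ℝ) 1 := by simp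
  have o01 : (1 : ℝ) ∈ Icc (0 : ℝ) 1 := by simp
  have hFc : ContinuousOn (fun t => ∫ s in (0 : ℝ)..t, γ.minSpeed α s) (Icc 0 1) :=
    intervalIntegral.continuousOn_primitive_interval' (hint z01 o01) (by simp) |>.mono (by
      rw [uIcc_of_le zero_le_one])
  have hivt : Icc (∫ s in (0 : ℝ)..0, γ.minSpeed α s) (∫ s in (0 : ℝ)..1, γ.minSpeed α s) ⊆ _ :=
    intermediate_value_Icc zero_le_one hFc
  rw [intervalIntegral.integral_same] at hivt
  have hc0 : (0 : ℝ) ≤ c := c.2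
  have hL : ∫ s in (0 : ℝ)..1, γ.minSpeed α s = L := rfl
  obtain ⟨a, ha, hFa⟩ := hivt (show (L - c) / 3 ∈ Icc 0 _ from ⟨by linarith, by rw [hL]; linarith⟩)
  obtain ⟨b, hb, hFb⟩ := hivt (show L - (L - c) / 3 ∈ Icc 0 _ from
    ⟨by linarith, by rw [hL]; linarith⟩)
  simp only at hFa hFb
  have hab : a ≤ b := by
    by_contra! hba
    have := intervalIntegral.integral_add_adjacent_intervals (hint z01 hb) (hint hb ha)
    have h2 : 0 ≤ ∫ s in b..a, γ.minSpeed α s := intervalIntegral.integral_nonneg hba.le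
      fun s hs => hm0 s ⟨hb.1.trans hs.1, hs.2.trans ha.2⟩
    linarith
  have hIab := intervalIntegral.integral_add_adjacent_intervals (hint z01 ha) (hint ha hb)
  have hIb1 := intervalIntegral.integral_add_adjacent_intervals (hint z01 hb) (hint hb o01)
  refine ⟨⟨γ.map a, γ.map_mem h0mem ha⟩, ⟨γ.map b, γ.map_mem h0mem hb⟩, ?_, ?_, ?_⟩
  · rw [← hα.lorentzDist_pos_iff]
    exact (ENNReal.ofReal_pos.2 (by linarith)).trans_le
      (hγ.integral_le_lorentzDist hα le_rfl ha.1 ha.2 h0 rfl)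
  · rw [← hα.lorentzDist_pos_iff]
    exact (ENNReal.ofReal_pos.2 (by linarith)).trans_le
      (hγ.integral_le_lorentzDist hα hb.1 hb.2 le_rfl rfl h1)
  · refine lt_of_lt_of_le ?_ (hγ.integral_le_lorentzDist hα ha.1 hab hb.2 rfl rfl)
    rw [← ENNReal.ofReal_coe_nnreal, ENNReal.ofReal_lt_ofReal_iff_of_nonneg hc0]
    linarith

/-- Composing a non-negative isotopy with a small piece of another isotopy, run backwards, moves
the end points at the cost of a controlled loss of length. -/
theorem Isotopy.IsNonneg.ofReal_sub_le_lorentzDist (hα : Ξ.IsContactForm α) {γ ζ : Ξ.Isotopy}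
    (hγ : γ.IsNonneg) {K r a b : ℝ} (hK : 0 < K)
    (hζK : ∀ t ∈ Icc (0 : ℝ) 1, ∀ x, ζ.speed α t x ≤ K) (hr : 0 < r) (hab : a < b)
    (hab01 : Icc a b ⊆ Icc 0 1) (hρ : ∀ s ∈ Icc a b, ∀ x, r ≤ α.confFactor (ζ.map s) x)
    {φ ψ : Ξ.Cont₀} (hφ : ζ.map b * γ.map 0 = φ) (hψ : ζ.map a * γ.map 1 = ψ) :
    ENNReal.ofReal (r * γ.lorentzLength α - K * (b - a)) ≤ Ξ.lorentzDist α φ ψ := by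
  rcases le_or_gt (r * γ.lorentzLength α - K * (b - a)) 0 with hle | hlt
  · rw [ENNReal.ofReal_of_nonpos hle]; exact zero_le
  have hmc := γ.continuousOn_minSpeed hα
  have hm0 := (Isotopy.isNonneg_iff_minSpeed hα γ).1 hγ
  have hu := uIcc_of_le (zero_le_one' ℝ)
  have hrK : 0 < r / K := div_pos hr hK
  set L := γ.lorentzLength α with hL
  have hθ : 0 < r / K * L - (b - a) := by
    have : r / K * L - (b - a) = (r * L - K * (b - a)) / K := by field_simp
    rw [this]; positivity
  -- The rate at which `ζ` runs back must satisfy `K q ≤ r · minSpeed` for the product to stay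
  -- non-negative, and must integrate to `b - a`. With the spare integral as the allowed error, `q₀`
  -- integrates to at least `b - a`; scaling it down then gives exactly `b - a`.
  obtain ⟨q₀, hq₀, hq⟩ := exists_contDiff_le (m := fun t => r / K * γ.minSpeed α t)
    (continuousOn_const.mul hmc) (fun t ht => mul_nonneg hrK.le (hm0 t ht)) hθ
  set Q := ∫ t in (0 : ℝ)..1, q₀ t with hQ
  have hmi := γ.intervalIntegrable_minSpeed hα (a := 0) (b := 1) (by simp) (by simp)
  have hQd : b - a ≤ Q := by
    have h1 : ∫ t in (0 : ℝ)..1, (r / K * γ.minSpeed α t - (r / K * L - (b - a))) ≤ Q :=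
      intervalIntegral.integral_mono_on zero_le_one
        ((hmi.const_mul _).sub intervalIntegrable_const) (hq₀.continuous.intervalIntegrable _ _)
        fun t ht => (hq t ht).2.2
    rw [intervalIntegral.integral_sub (hmi.const_mul _) intervalIntegrable_const,
      intervalIntegral.integral_const_mul, ← Isotopy.lorentzLength_eq, ← hL] at h1
    simp only [intervalIntegral.integral_const, sub_zero, one_smul] at h1
    linarith
  have hQ0 : 0 < Q := by linarith
  set q : ℝ → ℝ := fun t => (b - a) / Q * q₀ t
  have hqs : ContDiff ℝ ∞ q := contDiff_const.mul hq₀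
  have hd0 : 0 ≤ (b - a) / Q := div_nonneg (by linarith) hQ0.le
  have hq0 : ∀ t ∈ Icc (0 : ℝ) 1, 0 ≤ q t := fun t ht => mul_nonneg hd0 (hq t ht).1
  have hqm : ∀ t ∈ Icc (0 : ℝ) 1, K * q t ≤ r * γ.minSpeed α t := fun t ht => by
    have h1 : q t ≤ q₀ t := mul_le_of_le_one_left (hq t ht).1 ((div_le_one hQ0).2 hQd)
    calc K * q t ≤ K * (r / K * γ.minSpeed α t) :=
          mul_le_mul_of_nonneg_left (h1.trans (hq t ht).2.1) hK.le
      _ = r * γ.minSpeed α t := by field_simp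
  have hqint : ∫ t in (0 : ℝ)..1, q t = b - a := by
    simp only [q]
    rw [intervalIntegral.integral_const_mul, ← hQ, div_mul_cancel₀ _ hQ0.ne']
  obtain ⟨hUs, hUd⟩ := exists_contDiff_primitive hqs
  set g : ℝ → ℝ := fun t => b - ∫ s in (0 : ℝ)..t, q s with hgdef
  have hg : ContDiff ℝ ∞ g := contDiff_const.sub hUs
  have hgd : ∀ t, deriv g t = -q t := fun t => ((hUd t).const_sub b).deriv
  have hgab : MapsTo g (Icc 0 1) (Icc a b) := fun t ht => by
    have h := integral_mem_Icc_of_nonneg hqs.continuous hq0 ht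
    rw [hqint] at h
    exact ⟨by simp only [g]; linarith [h.2], by simp only [g]; linarith [h.1]⟩
  have hg01 : MapsTo g (Icc 0 1) (Icc 0 1) := fun t ht => hab01 (hgab ht)
  have hg0 : g 0 = b := by simp [g]
  have hg1 : g 1 = a := by simp only [g]; rw [hqint]; ring
  let P := (ζ.reparam g hg hg01).mul γ
  have hP : ∀ t ∈ Icc (0 : ℝ) 1, ∀ x, r * γ.minSpeed α t - K * q t ≤ P.speed α t x := by
    intro t ht x
    rw [Isotopy.speed_reparam_mul hα _ _ hg hg01 ht, hgd]
    have h1 : q t * ζ.speed α (g t) (γ.map t x) ≤ q t * K :=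
      mul_le_mul_of_nonneg_left (hζK _ (hg01 ht) _) (hq0 t ht)
    have hρ' := hρ _ (hgab ht) (γ.map t x)
    have h2 : r * γ.minSpeed α t ≤ α.confFactor (ζ.map (g t)) (γ.map t x) * γ.speed α t x :=
      mul_le_mul hρ' (γ.minSpeed_le hα ht x) (hm0 t ht) (hr.le.trans hρ')
    linarith
  have hPn : P.IsNonneg := (Isotopy.isNonneg_iff hα P).2 fun t ht x =>
    (sub_nonneg.2 (hqm t ht)).trans (hP t ht x)
  have hlen := P.integral_le_lorentzLength hα
    ((continuousOn_const.mul hmc).sub (continuousOn_const.mul hqs.continuous.continuousOn)) hP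
  simp only [Pi.sub_apply, Pi.mul_apply] at hlen
  rw [intervalIntegral.integral_sub (hmi.const_mul _)
    ((hqs.continuous.intervalIntegrable _ _).const_mul _), intervalIntegral.integral_const_mul,
    intervalIntegral.integral_const_mul, hqint, ← Isotopy.lorentzLength_eq, ← hL] at hlen
  refine (ENNReal.ofReal_le_ofReal hlen).trans (le_lorentzDist ?_ ?_ hPn)
  · simpa [P, Isotopy.mul, Isotopy.reparam, hg0] using hφ
  · simpa [P, Isotopy.mul, Isotopy.reparam, hg1] using hψ

theorem Isotopy.eventually_lt_confFactor (hα : Ξ.IsContactForm α) (ζ : Ξ.Isotopy) {s r : ℝ}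
    (hs : s ∈ Ioo (0 : ℝ) 1) (h1 : ζ.map s = 1) (hr : r < 1) :
    ∀ᶠ t in 𝓝 s, ∀ x, r < α.confFactor (ζ.map t) x := by
  have := (isCompact_univ (X := M)).eventually_forall_of_forall_eventually (x₀ := s)
    (P := fun t x => r < α.confFactor (ζ.map t) x) fun x _ => by
      have hc := (hα.continuousOn_confFactor ζ).continuousAt (x := (s, x))
        (prod_mem_nhds (Icc_mem_nhds hs.1 hs.2) univ_mem)
      refine hc.eventually (lt_mem_nhds ?_)
      simpa only [h1, hα.confFactor_one] using hr
  simpa using this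

/-- Upper semicontinuity: `ζ = η κ⁻¹` is positive and passes through the identity at time `1/2`,
where its conformal factor is `1`. Over a short interval around `1/2`, both the factor `r` and the
cost `2 K ε` of transporting isotopies back to `φ` and `ψ` are therefore harmless. -/
theorem exists_chronBefore_of_lorentzDist_lt (hα : Ξ.IsContactForm α) {η : Ξ.Isotopy}
    (hη : η.IsPositive) (h0 : η.map 0 ∈ Ξ.Cont₀) {φ ψ : Ξ.Cont₀} {c : ℝ≥0∞}
    (hc : Ξ.lorentzDist α φ ψ < c) :
    ∃ φ' ψ', Ξ.ChronBefore φ' φ ∧ Ξ.ChronBefore ψ ψ' ∧ Ξ.lorentzDist α φ' ψ' < c := by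
  obtain ⟨C, hTC, hCc⟩ := ENNReal.lt_iff_exists_nnreal_btwn.1 hc
  have hT : Ξ.lorentzDist α φ ψ ≠ ⊤ := (hc.trans_le le_top).ne
  set T := (Ξ.lorentzDist α φ ψ).toReal
  have hTC' : T < C := by
    have := ENNReal.toReal_strict_mono ENNReal.coe_ne_top hTC
    simpa using this
  have hT0 : 0 ≤ T := ENNReal.toReal_nonneg
  have half01 : (1 / 2 : ℝ) ∈ Icc (0 : ℝ) 1 := by constructor <;> norm_num
  let κ : Ξ.Cont₀ := ⟨η.map (1 / 2), η.map_mem h0 half01⟩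
  let ζ := η.mulRight κ⁻¹
  have hζ : ζ.IsPositive := hη.mulRight hα _
  have hζ0 : ζ.map 0 ∈ Ξ.Cont₀ := Ξ.Cont₀.mul_mem h0 (κ⁻¹).2
  have hζh : ζ.map (1 / 2) = 1 := by simp [ζ, κ]
  obtain ⟨K, hK, hKs⟩ := ζ.exists_abs_speed_le hα
  -- Chosen so that `r C` is the midpoint of `T` and `C`; the cost `2 K ε` may then use up the other
  -- half of the gap, and `r L - 2 K ε ≤ T` forces `L ≤ C`.
  set r := (T + C) / (2 * C)
  have hC : (0 : ℝ) < C := by linarith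
  have hr0 : 0 < r := by positivity
  have hr1 : r < 1 := (div_lt_one (by positivity)).2 (by linarith)
  obtain ⟨e, he, hball⟩ := Metric.eventually_nhds_iff.1
    (ζ.eventually_lt_confFactor hα (s := 1 / 2) ⟨by norm_num, by norm_num⟩ hζh hr1)
  obtain ⟨ε, hε, hεe, hε4, hεK⟩ : ∃ ε > 0, ε < e ∧ ε ≤ 1 / 4 ∧ K * (2 * ε) ≤ (C - T) / 2 := by
    have h2 : 0 < (C - T) / (4 * K) := div_pos (by linarith) (by positivity)
    have hm : 0 < min (e / 2) (min (1 / 4) ((C - T) / (4 * K))) :=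
      lt_min (by positivity) (lt_min (by norm_num) h2)
    refine ⟨_, hm, (min_le_left _ _).trans_lt (by linarith),
      (min_le_right _ _).trans (min_le_left _ _), ?_⟩
    have h3 := (le_div_iff₀ (by positivity)).1
      ((min_le_right (e / 2) _).trans (min_le_right (1 / 4) ((C - T) / (4 * K))))
    linarith
  have ha01 : 1 / 2 - ε ∈ Icc (0 : ℝ) 1 := ⟨by linarith, by linarith⟩
  have hb01 : 1 / 2 + ε ∈ Icc (0 : ℝ) 1 := ⟨by linarith, by linarith⟩
  let ζa : Ξ.Cont₀ := ⟨ζ.map (1 / 2 - ε), ζ.map_mem hζ0 ha01⟩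
  let ζb : Ξ.Cont₀ := ⟨ζ.map (1 / 2 + ε), ζ.map_mem hζ0 hb01⟩
  refine ⟨ζb⁻¹ * φ, ζa⁻¹ * ψ, ?_, ?_, lt_of_le_of_lt (lorentzDist_le fun γ hγ0 hγ1 hγ => ?_) hCc⟩
  · refine (hζ.mulRight hα (ζb⁻¹ * φ)).chronBefore hα half01.1 (by linarith : 1 / 2 < 1 / 2 + ε)
      hb01.2 ?_ ?_
    · rw [Isotopy.mulRight_map, hζh, one_mul]
    · simp [ζb]
  · refine (hζ.mulRight hα (ζa⁻¹ * ψ)).chronBefore hα ha01.1 (by linarith : 1 / 2 - ε < 1 / 2)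
      half01.2 ?_ ?_
    · simp [ζa]
    · rw [Isotopy.mulRight_map, hζh, one_mul]
  · have h := hγ.ofReal_sub_le_lorentzDist hα (ζ := ζ) (a := 1 / 2 - ε) (b := 1 / 2 + ε)
      (φ := φ) (ψ := ψ) hK
      (fun t ht x => (le_abs_self _).trans (hKs t ht x)) hr0 (by linarith)
      (Icc_subset_Icc ha01.1 hb01.2) (fun s hs x => (hball (by
        rw [Real.dist_eq, abs_lt]
        exact ⟨by linarith [hs.1], by linarith [hs.2]⟩) x).le)
      (by rw [hγ0]; simp [ζb]) (by rw [hγ1]; simp [ζa])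
    rw [ENNReal.ofReal_le_iff_le_toReal hT] at h
    have hrC : r * C = (T + C) / 2 := by simp only [r]; field_simp
    have h2 : r * γ.lorentzLength α ≤ r * C := by
      rw [hrC]
      have : (1 / 2 + ε - (1 / 2 - ε)) = 2 * ε := by ring
      rw [this] at h
      change _ ≤ T at h
      linarith
    rw [← ENNReal.ofReal_coe_nnreal]
    exact ENNReal.ofReal_le_ofReal (le_of_mul_le_mul_left h2 hr0)

theorem isOpen_chronPast (hα : Ξ.IsContactForm α) {η : Ξ.Isotopy} (hη : η.IsPositive)
    (h0 : η.map 0 ∈ Ξ.Cont₀) (χ : Ξ.Cont₀) : IsOpen[Ξ.intervalTopology] (Ξ.chronPast χ) := by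
  let _ := Ξ.intervalTopology
  refine isOpen_iff_mem_nhds.2 fun κ hκ => ?_
  obtain ⟨φ, hφ⟩ := (hη.exists_chronBefore hα h0 κ).1
  have ho : IsOpen (Ξ.chronFuture φ ∩ Ξ.chronPast χ) :=
    TopologicalSpace.isOpen_generateFrom_of_mem ⟨φ, χ, rfl⟩
  exact mem_of_superset (ho.mem_nhds ⟨hφ, hκ⟩) inter_subset_right

theorem isOpen_chronFuture (hα : Ξ.IsContactForm α) {η : Ξ.Isotopy} (hη : η.IsPositive)
    (h0 : η.map 0 ∈ Ξ.Cont₀) (χ : Ξ.Cont₀) : IsOpen[Ξ.intervalTopology] (Ξ.chronFuture χ) := by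
  let _ := Ξ.intervalTopology
  refine isOpen_iff_mem_nhds.2 fun κ hκ => ?_
  obtain ⟨φ, hφ⟩ := (hη.exists_chronBefore hα h0 κ).2
  have ho : IsOpen (Ξ.chronFuture χ ∩ Ξ.chronPast φ) :=
    TopologicalSpace.isOpen_generateFrom_of_mem ⟨χ, φ, rfl⟩
  exact mem_of_superset (ho.mem_nhds ⟨hκ, hφ⟩) inter_subset_left

/-- Two reverse triangle inequalities. This monotonicity turns an estimate at one pair `(φ', ψ')`
into an estimate on a neighbourhood bounded by pasts and futures. -/
theorem lorentzDist_le_lorentzDist (hα : Ξ.IsContactForm α) {φ φ' ψ ψ' : Ξ.Cont₀}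
    (h1 : Ξ.CausalBefore φ' φ) (h2 : Ξ.CausalBefore ψ ψ') :
    Ξ.lorentzDist α φ ψ ≤ Ξ.lorentzDist α φ' ψ' := by
  by_cases h : Ξ.CausalBefore φ ψ
  · exact le_add_self.trans ((hα.add_lorentzDist_le h1 h).trans
      (le_self_add.trans (hα.add_lorentzDist_le (h1.trans hα h) h2)))
  · rw [lorentzDist, if_neg h]; exact zero_le

theorem IsContactForm.continuous_lorentzDist_interval (hα : Ξ.IsContactForm α) :
    @Continuous (Ξ.Cont₀ × Ξ.Cont₀) ℝ≥0∞
      (@instTopologicalSpaceProd _ _ Ξ.intervalTopology Ξ.intervalTopology) inferInstance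
      (fun p => Ξ.lorentzDist α p.1 p.2) := by
  let _ := Ξ.intervalTopology
  by_cases hex : ∃ φ ψ : Ξ.Cont₀, Ξ.ChronBefore φ ψ
  · obtain ⟨φ₀, ψ₀, η, hη0, -, hη⟩ := hex
    have h0 : η.map 0 ∈ Ξ.Cont₀ := hη0 ▸ φ₀.2
    refine continuous_iff_continuousAt.2 fun ⟨φ, ψ⟩ => tendsto_order.2 ⟨fun c hc => ?_, fun c hc => ?_⟩
    · obtain ⟨φ', ψ', h1, h2, h3⟩ := exists_chronBefore_of_lt_lorentzDist hα hc
      filter_upwards [prod_mem_nhds ((isOpen_chronPast hα hη h0 φ').mem_nhds h1)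
        ((isOpen_chronFuture hα hη h0 ψ').mem_nhds h2)] with p hp
      exact h3.trans_le (lorentzDist_le_lorentzDist hα (ChronBefore.causalBefore hp.1)
        (ChronBefore.causalBefore hp.2))
    · obtain ⟨φ', ψ', h1, h2, h3⟩ := exists_chronBefore_of_lorentzDist_lt hα hη h0 hc
      filter_upwards [prod_mem_nhds ((isOpen_chronFuture hα hη h0 φ').mem_nhds h1)
        ((isOpen_chronPast hα hη h0 ψ').mem_nhds h2)] with p hp
      exact (lorentzDist_le_lorentzDist hα (ChronBefore.causalBefore hp.1)
        (ChronBefore.causalBefore hp.2)).trans_lt h3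
  · push Not at hex
    have : (fun p : Ξ.Cont₀ × Ξ.Cont₀ => Ξ.lorentzDist α p.1 p.2) = fun _ => 0 :=
      funext fun p => not_ne_iff.1 fun h =>
        hex p.1 p.2 (hα.lorentzDist_pos_iff.1 (pos_iff_ne_zero.2 h))
    rw [this]
    exact continuous_const

/-! ### Comparison of the Hofer and interval topologies -/

/-- A positive isotopy remains positive, up to reparametrisation, when multiplied by an isotopy
of small Hofer length. -/
theorem Isotopy.IsPositive.exists_mul_isPositive (hα : Ξ.IsContactForm α) {γ : Ξ.Isotopy}
    (hγ : γ.IsPositive) (h0 : γ.map 0 ∈ Ξ.Cont₀) :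
    ∃ δ > 0, ∀ (β : Ξ.Isotopy) (B : ℝ → ℝ), ContinuousOn B (Icc 0 1) →
      (∀ t ∈ Icc (0 : ℝ) 1, ∀ x, |β.speed α t x| ≤ B t) → ∫ t in (0 : ℝ)..1, B t < δ →
      ∃ P : Ξ.Isotopy, P.map 0 = γ.map 0 * β.map 0 ∧ P.map 1 = γ.map 1 * β.map 1 ∧
        P.IsPositive := by
  obtain ⟨k, hk, hks⟩ := hγ.exists_le_speed hα
  obtain ⟨ρ, hρ, R, hR, hρR⟩ := γ.exists_confFactor_bounds hα h0
  -- With clock rate `p`, the product has speed at least `p k - R B`. A rate `p > (R / k) B` of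
  -- total integral `1` exists because `(R / k) ∫ B < 1`.
  refine ⟨k / R, by positivity, fun β B hB hβ hlt => ?_⟩
  have hu := uIcc_of_le (zero_le_one' ℝ)
  have hBi : IntervalIntegrable B MeasureTheory.volume 0 1 := (hu ▸ hB).intervalIntegrable
  have hθ : 0 < 1 - R / k * ∫ t in (0 : ℝ)..1, B t := by
    have h1 : R / k * ∫ t in (0 : ℝ)..1, B t < R / k * (k / R) :=
      mul_lt_mul_of_pos_left hlt (by positivity)
    have h2 : R / k * (k / R) = 1 := by field_simp
    linarith
  obtain ⟨q, hq, hqB⟩ := exists_contDiff_gt (c := fun t => R / k * B t)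
    (continuousOn_const.mul hB) hθ
  have hqi : ∫ t in (0 : ℝ)..1, q t ≤ 1 := by
    have h1 : ∫ t in (0 : ℝ)..1, q t ≤
        ∫ t in (0 : ℝ)..1, (R / k * B t + (1 - R / k * ∫ t in (0 : ℝ)..1, B t)) :=
      intervalIntegral.integral_mono_on zero_le_one (hq.continuous.intervalIntegrable _ _)
        ((hBi.const_mul _).add intervalIntegrable_const) fun t ht => (hqB t ht).2
    rw [intervalIntegral.integral_add (hBi.const_mul _) intervalIntegrable_const,
      intervalIntegral.integral_const_mul] at h1
    simp only [intervalIntegral.integral_const, sub_zero, one_smul] at h1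
    linarith
  -- The added constant is non-negative, so it normalises the integral to `1` without spoiling the
  -- lower bound.
  set p : ℝ → ℝ := fun t => q t + (1 - ∫ t in (0 : ℝ)..1, q t)
  have hp : ContDiff ℝ ∞ p := hq.add contDiff_const
  have hpB : ∀ t ∈ Icc (0 : ℝ) 1, R / k * B t < p t := fun t ht => by
    simp only [p]; linarith [(hqB t ht).1]
  have hB0 : ∀ t ∈ Icc (0 : ℝ) 1, 0 ≤ B t := fun t ht =>
    (abs_nonneg _).trans (hβ t ht (Classical.arbitrary M))
  have hp0 : ∀ t ∈ Icc (0 : ℝ) 1, 0 ≤ p t := fun t ht =>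
    (mul_nonneg (by positivity) (hB0 t ht)).trans (hpB t ht).le
  have hpi : ∫ t in (0 : ℝ)..1, p t = 1 := by
    simp only [p]
    rw [intervalIntegral.integral_add (hq.continuous.intervalIntegrable _ _)
      intervalIntegrable_const]
    simp
  obtain ⟨hus, hud⟩ := exists_contDiff_primitive hp
  have hu01 : MapsTo (fun t => ∫ s in (0 : ℝ)..t, p s) (Icc 0 1) (Icc 0 1) := fun t ht => by
    have := integral_mem_Icc_of_nonneg hp.continuous hp0 ht
    rwa [hpi] at this
  refine ⟨(γ.reparam _ hus hu01).mul β, ?_, ?_, ?_⟩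
  · simp [Isotopy.mul, Isotopy.reparam]
  · simp [Isotopy.mul, Isotopy.reparam, hpi]
  · rw [Isotopy.isPositive_iff hα]
    intro t ht x
    rw [Isotopy.speed_reparam_mul hα _ _ hus hu01 ht, (hud t).deriv]
    have h1 : p t * k ≤ p t * γ.speed α _ (β.map t x) :=
      mul_le_mul_of_nonneg_left (hks _ (hu01 ht) (β.map t x)) (hp0 t ht)
    have hr := hρR _ (hu01 ht) (β.map t x)
    have h2 : |α.confFactor (γ.map (∫ s in (0 : ℝ)..t, p s)) (β.map t x) * β.speed α t x| ≤
        R * B t := by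
      rw [abs_mul, abs_of_pos (hρ.trans_le hr.1)]
      exact mul_le_mul hr.2 (hβ t ht x) (abs_nonneg _) hR.le
    have h3 : R * B t < p t * k := by
      have := mul_lt_mul_of_pos_right (hpB t ht) hk
      have e : R / k * B t * k = R * B t := by field_simp
      linarith
    linarith [(abs_le.1 h2).1]

theorem exists_hoferLength_lt {φ ψ : Ξ.Cont₀} {δ : ℝ} (h : Ξ.hoferDist α φ ψ < δ) :
    ∃ a : Ξ.Isotopy, a.map 0 = 1 ∧ a.map 1 = (ψ⁻¹ * φ : Ξ.Cont₀) ∧ a.hoferLength α < δ := by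
  obtain ⟨_, ⟨a, h0, h1, rfl⟩, hlt⟩ := exists_lt_of_csInf_lt (by
    obtain ⟨a, h0, h1⟩ := (ψ⁻¹ * φ).2
    exact ⟨_, a, h0, h1, rfl⟩) h
  exact ⟨a, h0, h1, hlt⟩

theorem ChronBefore.exists_hoferDist_past (hα : Ξ.IsContactForm α) {χ ψ : Ξ.Cont₀}
    (h : Ξ.ChronBefore χ ψ) : ∃ δ > 0, ∀ χ', Ξ.hoferDist α χ χ' < δ → Ξ.ChronBefore χ' ψ := by
  obtain ⟨γ, h0, h1, hγ⟩ := h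
  obtain ⟨δ, hδ, H⟩ := hγ.exists_mul_isPositive hα (h0 ▸ χ.2)
  refine ⟨δ, hδ, fun χ' hχ' => ?_⟩
  obtain ⟨a, ha0, ha1, hlt⟩ := exists_hoferLength_lt hχ'
  -- The translate of `a` runs from `χ⁻¹ χ'` to the identity, so the product runs from `χ'` to `ψ`.
  obtain ⟨P, hP0, hP1, hP⟩ := H (a.mulRight (χ'⁻¹ * χ)⁻¹) _ (a.continuousOn_maxAbsSpeed hα)
    (fun t ht x => by
      rw [Isotopy.speed_mulRight hα _ _ ht]
      exact a.abs_speed_le_maxAbsSpeed hα ht _) hlt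
  refine ⟨P, ?_, ?_, hP⟩
  · rw [hP0, h0, Isotopy.mulRight_map, ha0]; simp
  · rw [hP1, h1, Isotopy.mulRight_map, ha1]; simp

theorem ChronBefore.exists_hoferDist_future (hα : Ξ.IsContactForm α) {φ χ : Ξ.Cont₀}
    (h : Ξ.ChronBefore φ χ) : ∃ δ > 0, ∀ χ', Ξ.hoferDist α χ χ' < δ → Ξ.ChronBefore φ χ' := by
  obtain ⟨γ, h0, h1, hγ⟩ := h
  obtain ⟨δ, hδ, H⟩ := hγ.exists_mul_isPositive hα (h0 ▸ φ.2)
  refine ⟨δ, hδ, fun χ' hχ' => ?_⟩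
  obtain ⟨a, ha0, ha1, hlt⟩ := exists_hoferLength_lt hχ'
  have hg : ContDiff ℝ ∞ fun t : ℝ => 1 - t := contDiff_const.sub contDiff_id
  have hg01 : MapsTo (fun t : ℝ => 1 - t) (Icc 0 1) (Icc 0 1) := fun t ht =>
    ⟨by linarith [ht.2], by linarith [ht.1]⟩
  -- Time reversal makes this factor run from the identity to `χ⁻¹ χ'`, so the other end point
  -- moves, from `χ` to `χ'`.
  obtain ⟨P, hP0, hP1, hP⟩ := H ((a.reparam _ hg hg01).mulRight (χ'⁻¹ * χ)⁻¹)
    (fun t => a.maxAbsSpeed α (1 - t))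
    ((a.continuousOn_maxAbsSpeed hα).comp hg.continuous.continuousOn hg01)
    (fun t ht x => by
      rw [Isotopy.speed_mulRight hα _ _ ht, Isotopy.speed_reparam hα _ hg hg01 ht]
      have : deriv (fun t : ℝ => 1 - t) t = -1 := by simp
      rw [this, neg_one_mul, abs_neg]
      exact a.abs_speed_le_maxAbsSpeed hα (hg01 ht) _)
    (by
      rw [intervalIntegral.integral_comp_sub_left (fun t => a.maxAbsSpeed α t)]
      simpa [Isotopy.hoferLength_eq] using hlt)
  refine ⟨P, ?_, ?_, hP⟩
  · rw [hP0, h0, Isotopy.mulRight_map, Isotopy.reparam]; simp [ha1]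
  · rw [hP1, h1, Isotopy.mulRight_map, Isotopy.reparam]; simp [ha0]

/-- Openness is checked on balls around each point of an interval, so no metric axiom for `d_α` is
needed. -/
theorem IsContactForm.hoferTopology_le_intervalTopology (hα : Ξ.IsContactForm α) :
    Ξ.hoferTopology α ≤ Ξ.intervalTopology := by
  refine le_generateFrom ?_
  rintro _ ⟨φ, ψ, rfl⟩ χ ⟨h1, h2⟩
  obtain ⟨δ₁, hδ₁, H₁⟩ := ChronBefore.exists_hoferDist_future hα h1
  obtain ⟨δ₂, hδ₂, H₂⟩ := ChronBefore.exists_hoferDist_past hα h2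
  exact ⟨min δ₁ δ₂, lt_min hδ₁ hδ₂, fun χ' h => ⟨H₁ χ' (h.trans_le (min_le_left _ _)),
    H₂ χ' (h.trans_le (min_le_right _ _))⟩⟩

theorem IsContactForm.continuous_lorentzDist_hofer (hα : Ξ.IsContactForm α) :
    @Continuous (Ξ.Cont₀ × Ξ.Cont₀) ℝ≥0∞
      (@instTopologicalSpaceProd _ _ (Ξ.hoferTopology α) (Ξ.hoferTopology α)) inferInstance
      (fun p => Ξ.lorentzDist α p.1 p.2) :=
  continuous_le_dom (inf_le_inf (induced_mono hα.hoferTopology_le_intervalTopology)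
    (induced_mono hα.hoferTopology_le_intervalTopology)) hα.continuous_lorentzDist_interval

end CoorientedContactStructure
end ContactGeometry

end

theorem mainTheorem1 {n : ℕ} {M : Type*} [TopologicalSpace M] [T2Space M] [CompactSpace M]
    [Nonempty M] [ChartedSpace (EuclideanSpace ℝ (Fin (2 * n + 1))) M]
    [IsManifold (𝓡 (2 * n + 1)) ∞ M]
    (Ξ : ContactGeometry.CoorientedContactStructure n M)
    (α : ContactGeometry.OneForm n M) (hα : Ξ.IsContactForm α) :
    (∀ φ ψ : Ξ.Cont₀, 0 < Ξ.lorentzDist α φ ψ ↔ Ξ.ChronBefore φ ψ) ∧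
    (@Continuous (Ξ.Cont₀ × Ξ.Cont₀) ℝ≥0∞
        (@instTopologicalSpaceProd _ _ Ξ.intervalTopology Ξ.intervalTopology) inferInstance
        (fun p => Ξ.lorentzDist α p.1 p.2) ∧
      @Continuous (Ξ.Cont₀ × Ξ.Cont₀) ℝ≥0∞
        (@instTopologicalSpaceProd _ _ (Ξ.hoferTopology α) (Ξ.hoferTopology α)) inferInstance
        (fun p => Ξ.lorentzDist α p.1 p.2)) ∧
    (∀ φ₁ ψ φ₂ : Ξ.Cont₀, Ξ.CausalBefore φ₁ ψ → Ξ.CausalBefore ψ φ₂ →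
      Ξ.lorentzDist α φ₁ ψ + Ξ.lorentzDist α ψ φ₂ ≤ Ξ.lorentzDist α φ₁ φ₂) ∧
    (∀ ψ φ₁ φ₂ : Ξ.Cont₀,
      Ξ.lorentzDist α (ψ * φ₁) (ψ * φ₂) =
        Ξ.lorentzDist (α.pullback (ψ : ContactGeometry.Diffeo n M)) φ₁ φ₂) := by
  exact ⟨fun _ _ => hα.lorentzDist_pos_iff,
    ⟨hα.continuous_lorentzDist_interval, hα.continuous_lorentzDist_hofer⟩,
    fun _ _ _ => hα.add_lorentzDist_le, hα.lorentzDist_mul_left⟩
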